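/- Let $d\ge 2$ and $n\ge 1$ be integers. Put $C(m,d):=2\sum_{r=0}^{d-1}\binom{m-1}{r}$ for $m\ge1$, $C(0,d):=1$, and $C(m,d):=0$ for $m<0$. For a polyhedral convex cone $C\subset\mathbb R^d$ let $\mathcal F_k(C)$ be the set of its $k$-dimensional faces and let $$\Lambda_k(C):=\sum_{F\in\mathcal F_k(C)}V_k(F)$$ be its total $k$-face content. Here $V_k$ denotes the $k$-th conical intrinsic volume, $V_k(D)=\sum_{F\in\mathcal F_k(D)}\beta(0,F)\,\gamma(F,D)$, where $\beta(0,F)=\sigma_{m-1}(F\cap\mathbb S^{d-1})/\omega_m$ with $m=\dim F$ is the internal angle of $F$ at $0$ ($\sigma_{m-1}$ is the spherical Lebesgue measure on $(m-1)$-dimensional great subspheres, $\omega_m=\sigma_{m-1}(\mathbb S^{m-1})$, and $\beta(0,\{0\})=1$), and where the external angle $\gamma(F,D)=\beta(0,N(D,F))$ is the angle of the normal cone of $D$ at $F$. (In particular, $V_k(F)=\sigma_{k-1}(F\cap\mathbb S^{d-1})/\omega_k$ if $\dim F=k\geq 1$.) (a) Let $\phi^*$ be a Borel probability measure on the Grassmannian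 $G(d,d-1)$ of hyperplanes through $0$ that assigns measure zero to each set of hyperplanes containing a fixed line through $0$. Let $\mathcal H_1,\dots,\mathcal H_n$ be independent random hyperplanes with distribution $\phi^*$, and let the $(\phi^*,n)$-Schläfli cone $S_n$ be obtained by picking at random, with equal chances, one of the $d$-dimensional cones of the tessellation of $\mathbb R^d$ induced by $\mathcal H_1,\dots,\mathcal H_n$. Then, for $k=1,\dots,d$, $\Lambda_k(S_n)$ is integrable and $$\mathbb E\,\Lambda_k(S_n)=\frac{2^{d-k}\binom{n}{d-k}}{C(n,d)}.$$ (b) Let $\phi$ be a Borel probability measure on the unit sphere $\mathbb S^{d-1}$ that is even (invariant under $x\mapsto -x$) and assigns measure zero to each $(d-2)$-dimensional great subsphere. Let $X_1,\dots,X_n$ be independent random points with distribution $\phi$, and let the $(\phi,n)$-Cover–Efron cone $C_n$ be the positive hull of $X_1,\dots,X_n$ under the condition that this positive hull is different from $\mathbb R^d$. Then, for $k=1,\dots,d-1$, $\Lambda_k(C_n)$ is integrable and $$\mathbb E\,\Lambda_k(C_n)=\frac{\binom{n}{k}\,C(n-k,d-k)}{C(n,d)}.$$ -/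

import Mathlib

open MeasureTheory
open scoped RealInnerProductSpace

noncomputable section

namespace RandomCones

/-- The Euclidean space `ℝ^d`. -/
abbrev E (d : ℕ) : Type := EuclideanSpace ℝ (Fin d)

/-- The unit sphere `S^{d-1}` of `ℝ^d`. -/
abbrev Sph (d : ℕ) : Type := Metric.sphere (0 : E d) 1

/-! ### Convex cones, faces, angles -/

/-- The dimension of a convex cone: the dimension of its linear hull. -/
def coneDim {d : ℕ} (C : PointedCone ℝ (E d)) : ℕ :=
  Module.finrank ℝ (Submodule.span ℝ (C : Set (E d)))

/-- `F_k(C)`, the set of `k`-dimensional faces of a cone `C` (the cone itself is a face). -/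
def kFaces {d : ℕ} (k : ℕ) (C : PointedCone ℝ (E d)) : Set (PointedCone ℝ (E d)) :=
  {F | F.IsFaceOf C ∧ coneDim F = k}

/-- The normal cone `N(C, F)` of a cone `C` at its face `F`: all vectors of the dual cone
`C° = {y : ⟪y, x⟫ ≤ 0 for all x ∈ C}` that are orthogonal to `F`. -/
def normalCone {d : ℕ} (C F : PointedCone ℝ (E d)) : PointedCone ℝ (E d) where
  carrier := {y | (∀ x ∈ C, ⟪y, x⟫ ≤ 0) ∧ ∀ x ∈ F, ⟪y, x⟫ = 0}
  add_mem' := by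
    rintro a b ⟨ha, ha'⟩ ⟨hb, hb'⟩
    refine ⟨fun x hx => ?_, fun x hx => ?_⟩
    · rw [inner_add_left]
      exact add_nonpos (ha x hx) (hb x hx)
    · rw [inner_add_left, ha' x hx, hb' x hx, add_zero]
  zero_mem' := ⟨fun x _ => by simp, fun x _ => by simp⟩
  smul_mem' := by
    rintro ⟨c, hc⟩ a ⟨ha, ha'⟩
    refine ⟨fun x hx => ?_, fun x hx => ?_⟩
    · change ⟪c • a, x⟫ ≤ 0
      rw [real_inner_smul_left]
      exact mul_nonpos_of_nonneg_of_nonpos hc (ha x hx)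
    · change ⟪c • a, x⟫ = 0
      rw [real_inner_smul_left, ha' x hx, mul_zero]

/-- The internal angle `β(0, C) = σ_{m-1}(C ∩ S^{d-1}) / ω_m` of a cone `C` of dimension `m` at
the origin. Here `σ_{m-1}` is the spherical Lebesgue measure on the unit sphere of the linear
hull of `C`, and `ω_m` is its total mass. The angle of the cone `{0}` is `1` by convention. -/
def angle {d : ℕ} (C : PointedCone ℝ (E d)) : ℝ :=
  if coneDim C = 0 then 1
  else
    (volume : Measure (Submodule.span ℝ (C : Set (E d)))).toSphere.real {u | (u.1 : E d) ∈ C} /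
      (volume : Measure (Submodule.span ℝ (C : Set (E d)))).toSphere.real Set.univ

/-- The external angle `γ(F, C)` of a polyhedral cone `C` at its face `F`. -/
def extAngle {d : ℕ} (F C : PointedCone ℝ (E d)) : ℝ := angle (normalCone C F)

/-- The conical intrinsic volume `V_m(C) = ∑_{F ∈ F_m(C)} β(0, F) γ(F, C)` of a polyhedral
cone `C` (a polyhedral cone has finitely many faces, so that the sum is finite). -/
def intrinsicVolume {d : ℕ} (m : ℕ) (C : PointedCone ℝ (E d)) : ℝ :=
  ∑ᶠ F ∈ kFaces m C, angle F * extAngle F C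

/-- The total `k`-face content `Λ_k(C) = ∑_{F ∈ F_k(C)} V_k(F)` of a polyhedral cone `C`. -/
def faceContent {d : ℕ} (k : ℕ) (C : PointedCone ℝ (E d)) : ℝ :=
  ∑ᶠ F ∈ kFaces k C, intrinsicVolume k F

/-! ### Hyperplanes and Schläfli cones -/

/-- The Grassmannian `G(d, k)` of `k`-dimensional linear subspaces of `ℝ^d`. -/
def Grassmannian (d k : ℕ) : Type := {L : Submodule ℝ (E d) // Module.finrank ℝ L = k}

/-- The usual topology of `G(d, k)`: a subspace is identified with the orthogonal projection
onto it. -/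
instance instTopologicalSpaceGrassmannian (d k : ℕ) : TopologicalSpace (Grassmannian d k) :=
  TopologicalSpace.induced (fun L => (L.1.starProjection : E d →L[ℝ] E d)) inferInstance

/-- `G(d, k)` carries its Borel `σ`-algebra. -/
instance instMeasurableSpaceGrassmannian (d k : ℕ) : MeasurableSpace (Grassmannian d k) :=
  borel (Grassmannian d k)

instance instBorelSpaceGrassmannian (d k : ℕ) : BorelSpace (Grassmannian d k) := ⟨rfl⟩

/-- `⋂ᵢ uᵢ⁻`, the intersection of the halfspaces `uᵢ⁻ = {y : ⟪uᵢ, y⟫ ≤ 0}`. -/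
def halfspaceCone {d n : ℕ} (u : Fin n → E d) : PointedCone ℝ (E d) where
  carrier := {y | ∀ i, ⟪u i, y⟫ ≤ 0}
  add_mem' := by
    intro a b ha hb i
    rw [inner_add_right]
    exact add_nonpos (ha i) (hb i)
  zero_mem' := fun i => by simp
  smul_mem' := by
    rintro ⟨c, hc⟩ a ha i
    change ⟪u i, c • a⟫ ≤ 0
    rw [real_inner_smul_right]
    exact mul_nonpos_of_nonneg_of_nonpos hc (ha i)

/-- The Schläfli cones induced by the hyperplanes `H₁, …, Hₙ`, that is, the `d`-dimensional
cones of the conical tessellation that they induce: the `d`-dimensional cones that arise as an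
intersection of closed halfspaces, one bounded by each of the `Hᵢ`. -/
def schlafliCones {d n : ℕ} (H : Fin n → Grassmannian d (d - 1)) : Set (PointedCone ℝ (E d)) :=
  {C | (∃ u : Fin n → E d, (∀ i, u i ∈ (H i).1ᗮ ∧ u i ≠ 0) ∧ C = halfspaceCone u) ∧
    coneDim C = d}

/-- The mean of `g(C)` when `C` is picked at random, with equal chances, among the (finitely
many) Schläfli cones induced by `H₁, …, Hₙ`. -/
def schlafliMean {d n : ℕ} (g : PointedCone ℝ (E d) → ℝ) (H : Fin n → Grassmannian d (d - 1)) :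
    ℝ :=
  (∑ᶠ C ∈ schlafliCones H, g C) / (schlafliCones H).ncard

/-! ### The two random cones

The `(φ*, n)`-Schläfli cone `S_n` arises by a two-step experiment: first take independent random
hyperplanes `H₁, …, Hₙ` with distribution `φ*`, then pick one of the Schläfli cones induced by
them with equal chances. The expectation of `g(S_n)` is therefore the integral of `schlafliMean g`
with respect to the product measure `(φ*)ⁿ`.

The `(φ, n)`-Cover–Efron cone `C_n` is the positive hull of independent random points
`X₁, …, Xₙ` of the sphere with distribution `φ`, under the condition that this positive hull is
not the whole space. -/

/-- For a nonnegative functional `g`: `g(S_n)` is integrable and has the expectation `a`. -/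
def HasSchlafliExpectation {d : ℕ} (φ : Measure (Grassmannian d (d - 1))) (n : ℕ)
    (g : PointedCone ℝ (E d) → ℝ) (a : ℝ) : Prop :=
  Integrable (fun H : Fin n → Grassmannian d (d - 1) => schlafliMean g H)
      (Measure.pi fun _ : Fin n => φ) ∧
    ∫ H : Fin n → Grassmannian d (d - 1), schlafliMean g H ∂(Measure.pi fun _ : Fin n => φ) = a

/-- The positive hull `pos{x₁, …, xₙ}` of points of the sphere. -/
def posHull {d n : ℕ} (x : Fin n → Sph d) : PointedCone ℝ (E d) :=
  PointedCone.hull ℝ (Set.range fun i => (x i : E d))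

/-- The distribution of `(X₁, …, Xₙ)` under the condition `pos{X₁, …, Xₙ} ≠ ℝ^d`. -/
def coverEfronMeasure {d : ℕ} (φ : Measure (Sph d)) (n : ℕ) : Measure (Fin n → Sph d) :=
  ProbabilityTheory.cond (Measure.pi fun _ : Fin n => φ) {x | posHull x ≠ ⊤}

/-- `g(C_n)` is integrable and has the expectation `a`. -/
def HasCoverEfronExpectation {d : ℕ} (φ : Measure (Sph d)) (n : ℕ)
    (g : PointedCone ℝ (E d) → ℝ) (a : ℝ) : Prop :=
  Integrable (fun x : Fin n → Sph d => g (posHull x)) (coverEfronMeasure φ n) ∧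
    ∫ x : Fin n → Sph d, g (posHull x) ∂(coverEfronMeasure φ n) = a

/-- The numbers `C(n, d) = 2 ∑_{r=0}^{d-1} binom(n-1, r)` for `n ≥ 1`, with `C(0, d) = 1` and
`C(n, d) = 0` for `n < 0`. -/
def schlafliNumber (n : ℤ) (d : ℕ) : ℕ :=
  if n < 0 then 0
  else if n = 0 then 1
  else 2 * ∑ r ∈ Finset.range d, (n.toNat - 1).choose r

end RandomCones

end

noncomputable section

namespace RandomCones

/-! ### Signs and general position -/

/-! Both formulas come from averaging over signs. Almost surely the normals, respectively the
points, `x i` are in general position (`ae_genPos`). For fixed `x` in general position one sums over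
all sign vectors `ε` the contribution of the cone built from the `± x i`. Since the only `k`-face of
a `k`-dimensional cone is the cone itself, the content is the sum of the angles of the `k`-faces
(`faceContent_eq`).

(a) The Schläfli cones are the cells of the arrangement of the hyperplanes `(x i)ᗮ`, and their
number is `C(n, d)` by Schläfli's theorem (`feasibleCount_eq`). A `k`-face is cut out by a set `I`
of `d - k` indices and is a cell of the arrangement induced in the `k`-dimensional space `orth x I`.
The angles of these cells add up to 1, and each cell is counted once for each of the `2 ^ (d - k)`
choices of signs on `I`. So the mean over the cells is the same constant for every `x` in general
position.

(b) As `φ` is even, an expectation is `2⁻ⁿ` times the expected sum over all `ε`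
(`integral_eq_of_sum_flip`). A `k`-face of the positive hull is spanned by `k` vectors, with index
set `I`. Whether they span a face depends only on the signs off `I`, and `C(n - k, d - k)` choices
are good by Schläfli's theorem in `orth x I`. The angle depends only on the signs on `I`, and the `2
^ k` angles add up to 1. The sum therefore factorizes (`GenPos.sum_faceContent_faceCone`). The same
averaging gives the conditioning event probability `C(n, d) / 2 ^ n`; off this event there are no
`k`-faces, so the conditional mean is a quotient. -/

/-- The real sign encoded by a Boolean. -/
def sgn (b : Bool) : ℝ := if b then 1 else -1

@[simp] lemma sgn_true : sgn true = 1 := rfl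

@[simp] lemma sgn_false : sgn false = -1 := rfl

lemma sgn_ne_zero (b : Bool) : sgn b ≠ 0 := by cases b <;> simp

lemma sgn_mul_self (b : Bool) : sgn b * sgn b = 1 := by cases b <;> simp

/-- Any at most `d` of the vectors `f i` are linearly independent. -/
def GenPos {ι V : Type*} [AddCommGroup V] [Module ℝ V] (d : ℕ) (f : ι → V) : Prop :=
  ∀ S : Finset ι, S.card ≤ d → LinearIndepOn ℝ f (S : Set ι)

lemma GenPos.comp {ι κ V : Type*} [AddCommGroup V] [Module ℝ V] {d : ℕ} {f : ι → V}
    (h : GenPos d f) (g : κ → ι) (hg : Function.Injective g) : GenPos d (f ∘ g) := by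
  classical
  intro S hS
  have := h (S.image g) (by rwa [Finset.card_image_of_injective _ hg])
  rw [Finset.coe_image] at this
  exact this.comp_of_image hg.injOn

lemma GenPos.smul {ι V : Type*} [AddCommGroup V] [Module ℝ V] {d : ℕ} {f : ι → V}
    (h : GenPos d f) {c : ι → ℝ} (hc : ∀ i, c i ≠ 0) : GenPos d (fun i => c i • f i) := by
  intro S hS
  have := (h S hS).linearIndependent.units_smul (fun i => Units.mk0 (c i) (hc i))
  exact this

/-! ### Counting the cells of an arrangement in general position -/

lemma schlafliNumber_natCast_succ (m d : ℕ) :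
    schlafliNumber ((m + 1 : ℕ) : ℤ) d = 2 * ∑ r ∈ Finset.range d, m.choose r := by
  have h1 : ¬ ((m + 1 : ℕ) : ℤ) < 0 := by omega
  have h2 : ¬ ((m + 1 : ℕ) : ℤ) = 0 := by omega
  rw [schlafliNumber, if_neg h1, if_neg h2, Int.toNat_natCast, Nat.add_sub_cancel]

lemma schlafliNumber_natCast_succ_zero (m : ℕ) : schlafliNumber ((m + 1 : ℕ) : ℤ) 0 = 0 := by
  rw [schlafliNumber_natCast_succ, Finset.sum_range_zero, mul_zero]

/-- Pascal's rule, in the form matching deletion and restriction of a hyperplane. The case `m = 0`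
is separate because `C(0, d) = 1` is not given by the sum. -/
lemma schlafliNumber_succ_succ (m d : ℕ) :
    schlafliNumber ((m + 1 : ℕ) : ℤ) (d + 1) =
      schlafliNumber (m : ℤ) (d + 1) + schlafliNumber (m : ℤ) d := by
  rw [schlafliNumber_natCast_succ]
  cases m with
  | zero => simp [schlafliNumber, Finset.sum_range_succ']
  | succ m =>
    rw [schlafliNumber_natCast_succ, schlafliNumber_natCast_succ, ← mul_add, Finset.sum_range_succ',
      Finset.sum_range_succ' (fun r => m.choose r)]
    simp only [Nat.choose_succ_succ, Finset.sum_add_distrib, Nat.choose_zero_right]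
    ring

/-- The sign vector `ε` is attained strictly by the functionals `f`. -/
def Feasible {ι V : Type*} [AddCommGroup V] [Module ℝ V] (f : ι → Module.Dual ℝ V)
    (ε : ι → Bool) : Prop :=
  ∃ y, ∀ i, 0 < sgn (ε i) * f i y

open Classical in
/-- The number of sign vectors attained strictly by the functionals `f`. -/
def feasibleCount {ι V : Type*} [Fintype ι] [AddCommGroup V] [Module ℝ V]
    (f : ι → Module.Dual ℝ V) : ℕ :=
  ∑ ε : ι → Bool, if Feasible f ε then 1 else 0

lemma feasibleCount_eq_sum {ι V : Type*} [Fintype ι] [DecidableEq ι] [AddCommGroup V]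
    [Module ℝ V] (f : ι → Module.Dual ℝ V) [DecidablePred (Feasible f)] :
    feasibleCount f = ∑ ε : ι → Bool, if Feasible f ε then 1 else 0 := by
  unfold feasibleCount
  congr!

lemma exists_pos_perturb {ι : Type*} [Finite ι] (a b : ι → ℝ) (ha : ∀ i, 0 < a i) :
    ∃ t > 0, ∀ i, 0 < a i + t * b i ∧ 0 < a i - t * b i := by
  have key : ∀ i, ∀ᶠ t in nhdsWithin (0 : ℝ) (Set.Ioi 0),
      0 < a i + t * b i ∧ 0 < a i - t * b i := by
    intro i
    have h1 : ContinuousAt (fun t : ℝ => a i + t * b i) 0 := by fun_prop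
    have h2 : ContinuousAt (fun t : ℝ => a i - t * b i) 0 := by fun_prop
    have e1 := h1.eventually_const_lt (u := 0) (by simpa using ha i)
    have e2 := h2.eventually_const_lt (u := 0) (by simpa using ha i)
    exact (e1.and e2).filter_mono nhdsWithin_le_nhds
  have h := (Filter.eventually_all.2 key).and self_mem_nhdsWithin
  obtain ⟨t, ht, ht0⟩ := h.exists
  exact ⟨t, ht0, ht⟩

/-- A combination that vanishes on the kernel of `f none` is a multiple of `f none`, which yields a
relation among at most `d + 1` of the original functionals. -/
lemma GenPos.restrict_ker {ι V : Type*} [AddCommGroup V] [Module ℝ V] {d : ℕ}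
    {f : Option ι → Module.Dual ℝ V} (h : GenPos (d + 1) f) :
    GenPos d (fun i => (f (some i)).domRestrict (LinearMap.ker (f none))) := by
  classical
  intro S hS
  rw [linearIndepOn_finset_iff]
  intro c hc i hi
  have hker : LinearMap.ker (f none) ≤ LinearMap.ker (∑ i ∈ S, c i • f (some i)) := by
    intro y hy
    have := LinearMap.congr_fun hc ⟨y, hy⟩
    simpa [LinearMap.sum_apply] using this
  have h0 : f none ≠ 0 := by
    have := h {none} (by simp)
    simpa using this
  obtain ⟨w, hw⟩ := DFunLike.ne_iff.1 h0
  rw [LinearMap.zero_apply] at hw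
  obtain ⟨a, ha⟩ : ∃ a : ℝ, ∑ i ∈ S, c i • f (some i) = a • f none := by
    refine ⟨(∑ i ∈ S, c i • f (some i)) w / f none w, LinearMap.ext fun y => ?_⟩
    have := hker (x := y - (f none y / f none w) • w) (by simp [hw])
    rw [LinearMap.mem_ker, map_sub, map_smul, sub_eq_zero] at this
    rw [this, LinearMap.smul_apply, smul_eq_mul, smul_eq_mul]
    ring
  have hI := h (insert none (S.map Function.Embedding.some)) (by
    rw [Finset.card_insert_of_notMem (by simp), Finset.card_map]; omega)
  rw [linearIndepOn_finset_iff] at hI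
  have := hI (fun o => o.elim (-a) c) (by
    rw [Finset.sum_insert (by simp), Finset.sum_map]
    simp [ha]) (some i) (by simp [hi])
  simpa using this

lemma ite_add_ite_of_iff (T F K A : Prop) [Decidable T] [Decidable F] [Decidable K] [Decidable A]
    (h1 : K → T ∧ F) (h2 : T → F → K) (h3 : A ↔ T ∨ F) :
    (if T then 1 else 0) + (if F then 1 else 0) =
      (if A then 1 else 0) + if K then 1 else 0 := by
  by_cases hT : T <;> by_cases hF : F <;> by_cases hK : K <;> simp_all

/-- Deletion and restriction: the hyperplane `f none = 0` splits a cell of the other functionals in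
two exactly when it meets that cell, that is, when the sign vector is feasible on the kernel. -/
lemma feasibleCount_option {ι V : Type*} [Fintype ι] [AddCommGroup V] [Module ℝ V]
    (f : Option ι → Module.Dual ℝ V) (h0 : f none ≠ 0) :
    feasibleCount f = feasibleCount (fun i => f (some i)) +
      feasibleCount (fun i => (f (some i)).domRestrict (LinearMap.ker (f none))) := by
  classical
  rw [feasibleCount_eq_sum, feasibleCount_eq_sum, feasibleCount_eq_sum]
  let e : (Option ι → Bool) ≃ Bool × (ι → Bool) := Equiv.piOptionEquivProd
  rw [← e.symm.sum_comp, Fintype.sum_prod_type_right, ← Finset.sum_add_distrib]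
  refine Finset.sum_congr rfl fun ε _ => ?_
  rw [Fintype.sum_bool]
  obtain ⟨w, hw⟩ : ∃ w, f none w = 1 := by
    obtain ⟨w, hw⟩ := DFunLike.ne_iff.1 h0
    exact ⟨(f none w)⁻¹ • w, by simpa using inv_mul_cancel₀ hw⟩
  have hT : Feasible f (e.symm (true, ε)) ↔
      ∃ y, 0 < f none y ∧ ∀ i, 0 < sgn (ε i) * f (some i) y := by
    simp [Feasible, Option.forall, e, Equiv.piOptionEquivProd]
  have hF : Feasible f (e.symm (false, ε)) ↔
      ∃ y, f none y < 0 ∧ ∀ i, 0 < sgn (ε i) * f (some i) y := by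
    simp [Feasible, Option.forall, e, Equiv.piOptionEquivProd]
  have hK : Feasible (fun i => (f (some i)).domRestrict (LinearMap.ker (f none))) ε ↔
      ∃ y, f none y = 0 ∧ ∀ i, 0 < sgn (ε i) * f (some i) y := by
    simp [Feasible]
  simp only [hT, hF, hK]
  have hKT : (∃ y, f none y = 0 ∧ ∀ i, 0 < sgn (ε i) * f (some i) y) →
      (∃ y, 0 < f none y ∧ ∀ i, 0 < sgn (ε i) * f (some i) y) ∧
      (∃ y, f none y < 0 ∧ ∀ i, 0 < sgn (ε i) * f (some i) y) := by
    rintro ⟨y, hy, hp⟩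
    -- A cell point on the hyperplane is pushed to either side along `w`.
    obtain ⟨t, ht, H⟩ := exists_pos_perturb _ (fun i => sgn (ε i) * f (some i) w) hp
    refine ⟨⟨y + t • w, by simp [hy, hw, ht], fun i => ?_⟩,
      ⟨y - t • w, by simp [hy, hw, ht], fun i => ?_⟩⟩
    · have := (H i).1
      simp only [map_add, map_smul, smul_eq_mul]; linarith
    · have := (H i).2
      simp only [map_sub, map_smul, smul_eq_mul]; linarith
  have hTFK : (∃ y, 0 < f none y ∧ ∀ i, 0 < sgn (ε i) * f (some i) y) →
      (∃ y, f none y < 0 ∧ ∀ i, 0 < sgn (ε i) * f (some i) y) →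
      ∃ y, f none y = 0 ∧ ∀ i, 0 < sgn (ε i) * f (some i) y := by
    rintro ⟨y, hy, hp⟩ ⟨z, hz, hq⟩
    -- Up to a positive factor, this is where the segment from `y` to `z` crosses the hyperplane.
    refine ⟨(-f none z) • y + f none y • z, by simp; ring, fun i => ?_⟩
    have h1 := mul_pos (neg_pos.2 hz) (hp i)
    have h2 := mul_pos hy (hq i)
    simp only [map_add, map_smul, smul_eq_mul]; linarith
  have hall : Feasible (fun i => f (some i)) ε ↔
      (∃ y, 0 < f none y ∧ ∀ i, 0 < sgn (ε i) * f (some i) y) ∨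
      (∃ y, f none y < 0 ∧ ∀ i, 0 < sgn (ε i) * f (some i) y) := by
    constructor
    · rintro ⟨y, hy⟩
      rcases lt_trichotomy (f none y) 0 with h | h | h
      · exact Or.inr ⟨y, h, hy⟩
      · exact Or.inl (hKT ⟨y, h, hy⟩).1
      · exact Or.inl ⟨y, h, hy⟩
    · rintro (⟨y, -, hy⟩ | ⟨y, -, hy⟩) <;> exact ⟨y, hy⟩
  exact ite_add_ite_of_iff _ _ _ _ hKT hTFK hall

lemma feasibleCount_equiv {ι κ V : Type*} [Fintype ι] [Fintype κ] [AddCommGroup V] [Module ℝ V]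
    (e : ι ≃ κ) (f : κ → Module.Dual ℝ V) : feasibleCount (f ∘ e) = feasibleCount f := by
  classical
  rw [feasibleCount_eq_sum, feasibleCount_eq_sum, ← (e.arrowCongr (Equiv.refl Bool)).sum_comp]
  refine Finset.sum_congr rfl fun ε _ => if_congr ?_ rfl rfl
  unfold Feasible
  refine exists_congr fun y => ?_
  rw [← e.forall_congr_right]
  simp

/-- Schläfli's theorem on the number of cells of an arrangement of hyperplanes through `0` in
general position. -/
theorem feasibleCount_eq {ι : Type} [Fintype ι] :
    ∀ {V : Type} [AddCommGroup V] [Module ℝ V] [FiniteDimensional ℝ V]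
      (f : ι → Module.Dual ℝ V), GenPos (Module.finrank ℝ V) f →
      feasibleCount f = schlafliNumber (Fintype.card ι : ℤ) (Module.finrank ℝ V) := by
  classical
  refine Fintype.induction_empty_option (P := fun ι _ => ∀ {V : Type} [AddCommGroup V]
    [Module ℝ V] [FiniteDimensional ℝ V] (f : ι → Module.Dual ℝ V),
    GenPos (Module.finrank ℝ V) f →
      feasibleCount f = schlafliNumber (Fintype.card ι : ℤ) (Module.finrank ℝ V)) ?_ ?_ ?_ ι
  · intro α β _ e ih V _ _ _ f hf
    let _ := Fintype.ofEquiv β e.symm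
    rw [← feasibleCount_equiv e f, ← Fintype.card_congr e]
    convert ih (f ∘ e) (hf.comp e e.injective)
  · intro V _ _ _ f hf
    have : ∀ ε, Feasible f ε := fun ε => ⟨0, fun i => i.elim⟩
    simp [feasibleCount, this, schlafliNumber]
  · intro α _ ih V _ _ _ f hf
    rw [Fintype.card_option]
    -- In dimension 0 a functional cannot be positive anywhere, matching `C(m + 1, 0) = 0`; in
    -- positive dimension general position makes `f none` nonzero.
    rcases Nat.eq_zero_or_pos (Module.finrank ℝ V) with h0 | hpos
    · have : ∀ ε, ¬ Feasible f ε := by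
        rintro ε ⟨y, hy⟩
        have := Module.finrank_zero_iff.1 h0
        have h := hy none
        rw [Subsingleton.elim y 0] at h
        simp at h
      rw [h0, schlafliNumber_natCast_succ_zero]
      simp [feasibleCount, this]
    · obtain ⟨d, hd⟩ := Nat.exists_eq_succ_of_ne_zero hpos.ne'
      have hne : f none ≠ 0 := by
        have := hf {none} (by rw [Finset.card_singleton]; exact hpos)
        simpa using this
      have hk : Module.finrank ℝ (LinearMap.ker (f none)) = d := by
        have := Module.Dual.finrank_ker_add_one_of_ne_zero hne
        omega
      rw [feasibleCount_option f hne, hd, Nat.succ_eq_add_one, schlafliNumber_succ_succ]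
      congr 1
      · rw [ih (fun i => f (some i)) (hf.comp some (Option.some_injective _)), hd]
      · have := ih (fun i => (f (some i)).domRestrict (LinearMap.ker (f none)))
          (by rw [hk]; exact GenPos.restrict_ker (by rwa [hd] at hf))
        rw [this, hk]

/-! ### Supporting functionals under general position -/

/-- The vectors `x i`, `i ∈ I`, span a face of the positive hull of all the `x i`: there is a
linear functional vanishing at the former and positive at the other `x i`. -/
def SupportedOn {ι : Type} {d : ℕ} (x : ι → E d) (I : Finset ι) : Prop :=
  ∃ y, (∀ i ∈ I, ⟪x i, y⟫ = 0) ∧ ∀ i, i ∉ I → 0 < ⟪x i, y⟫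

/-- The vectors `x i` with signs given by `ε`. -/
def signed {ι : Type} {d : ℕ} (ε : ι → Bool) (x : ι → E d) : ι → E d := fun i => sgn (ε i) • x i

lemma GenPos.signed {ι : Type} {d e : ℕ} {x : ι → E d} (h : GenPos e x) (ε : ι → Bool) :
    GenPos e (signed ε x) :=
  h.smul fun i => sgn_ne_zero (ε i)

/-- Prescribe the values on a basis of the span, extend the functional to the whole space and
represent it by a vector. -/
lemma exists_inner_eq {ι : Type} {d : ℕ} {x : ι → E d} {S : Finset ι}
    (h : LinearIndepOn ℝ x (S : Set ι)) (c : ι → ℝ) : ∃ z, ∀ i ∈ S, ⟪x i, z⟫ = c i := by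
  let b := Module.Basis.span h
  obtain ⟨f, hf⟩ := LinearMap.exists_extend (b.constr ℝ fun i => c i)
  refine ⟨(InnerProductSpace.toDual ℝ (E d)).symm f.toContinuousLinearMap, fun i hi => ?_⟩
  rw [real_inner_comm, InnerProductSpace.toDual_symm_apply]
  have h1 := LinearMap.congr_fun hf (b ⟨i, hi⟩)
  rw [Module.Basis.constr_basis] at h1
  rw [← h1]
  exact congrArg f (Module.Basis.coe_span_apply h ⟨i, hi⟩).symm

lemma GenPos.eq_zero_of_inner_eq_zero {ι : Type} {d : ℕ} {x : ι → E d} (h : GenPos d x)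
    {T : Finset ι} (hT : d ≤ T.card) {y : E d} (hy : ∀ i ∈ T, ⟪x i, y⟫ = 0) : y = 0 := by
  obtain ⟨S, hST, hS⟩ := Finset.exists_subset_card_eq hT
  have hli := (h S hS.le).linearIndependent
  have htop := hli.span_eq_top_of_card_eq_finrank' (by simp [hS])
  have hy' : y ∈ (Submodule.span ℝ (Set.range fun i : (S : Set ι) => x i))ᗮ := by
    rw [Submodule.mem_orthogonal]
    intro u hu
    induction hu using Submodule.span_induction with
    | mem u hu => obtain ⟨i, rfl⟩ := hu; exact hy i (hST i.2)
    | zero => simp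
    | add u v _ _ hu hv => rw [inner_add_left, hu, hv, add_zero]
    | smul a u _ hu => rw [real_inner_smul_left, hu, mul_zero]
  rwa [htop, Submodule.top_orthogonal_eq_bot, Submodule.mem_bot] at hy'

/-- Perturb `y` by a small multiple of a vector `z` whose inner products are 0 on `I` and 1 on `J \
I`. -/
lemma GenPos.supportedOn_of_nonneg {ι : Type} [Fintype ι] {d : ℕ} {x : ι → E d} (h : GenPos d x)
    {I J : Finset ι} (hIJ : I ⊆ J) (hJ : J.card ≤ d) {y : E d} (hy0 : ∀ i ∈ J, ⟪x i, y⟫ = 0)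
    (hy : ∀ i, i ∉ J → 0 < ⟪x i, y⟫) : SupportedOn x I := by
  classical
  obtain ⟨z, hz⟩ := exists_inner_eq (h J hJ) (fun i => if i ∈ I then 0 else 1)
  obtain ⟨t, ht, H⟩ := exists_pos_perturb (fun i : {i // i ∉ J} => ⟪x i, y⟫)
    (fun i => ⟪x i, z⟫) (fun i => hy i i.2)
  refine ⟨y + t • z, fun i hi => ?_, fun i hi => ?_⟩
  · rw [inner_add_right, real_inner_smul_right, hz i (hIJ hi), hy0 i (hIJ hi)]
    simp [hi]
  · rw [inner_add_right, real_inner_smul_right]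
    by_cases hJ' : i ∈ J
    · rw [hz i hJ', hy0 i hJ']
      simp [hi, ht]
    · exact (H ⟨i, hJ'⟩).1

/-- Weak support can be made strict: the zero set of a nonzero `y` has at most `d` indices, since
`d` of the vectors already span, so the perturbation applies to it. -/
lemma GenPos.supportedOn_of_nonneg_of_ne_zero {ι : Type} [Fintype ι] {d : ℕ} {x : ι → E d}
    (h : GenPos d x) {I : Finset ι} {y : E d} (hy : y ≠ 0) (hy0 : ∀ i ∈ I, ⟪x i, y⟫ = 0)
    (hpos : ∀ i, 0 ≤ ⟪x i, y⟫) : SupportedOn x I := by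
  classical
  refine h.supportedOn_of_nonneg (J := Finset.univ.filter fun i => ⟪x i, y⟫ = 0)
    (fun i hi => by simpa using hy0 i hi) ?_ (fun i hi => by simpa using hi)
    (fun i hi => lt_of_le_of_ne (hpos i) (Ne.symm (by simpa using hi)))
  by_contra hlt
  exact hy (h.eq_zero_of_inner_eq_zero (not_le.1 hlt).le fun i hi => by simpa using hi)

lemma GenPos.supportedOn_mono {ι : Type} [Fintype ι] {d : ℕ} {x : ι → E d}
    (h : GenPos d x) {I J : Finset ι} (hIJ : I ⊆ J) (hJ : J.card ≤ d) (hs : SupportedOn x J) :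
    SupportedOn x I := by
  obtain ⟨y, h0, h1⟩ := hs
  exact h.supportedOn_of_nonneg hIJ hJ h0 h1

/-! ### The arrangement induced in an orthogonal complement -/

/-- The orthogonal complement of the vectors `x i`, `i ∈ I`. -/
def orth {ι : Type} {d : ℕ} (x : ι → E d) (I : Finset ι) : Submodule ℝ (E d) :=
  (Submodule.span ℝ (x '' I))ᗮ

lemma mem_orth {ι : Type} {d : ℕ} {x : ι → E d} {I : Finset ι} {y : E d} :
    y ∈ orth x I ↔ ∀ i ∈ I, ⟪x i, y⟫ = 0 := by
  rw [orth, Submodule.mem_orthogonal]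
  refine ⟨fun h i hi => h _ (Submodule.subset_span ⟨i, hi, rfl⟩), fun h u hu => ?_⟩
  induction hu using Submodule.span_induction with
  | mem u hu => obtain ⟨i, hi, rfl⟩ := hu; exact h i hi
  | zero => simp
  | add u v _ _ hu hv => rw [inner_add_left, hu, hv, add_zero]
  | smul a u _ hu => rw [real_inner_smul_left, hu, mul_zero]

lemma GenPos.finrank_span {ι : Type} {d e : ℕ} {x : ι → E d} (h : GenPos e x)
    {I : Finset ι} (hI : I.card ≤ e) : Module.finrank ℝ (Submodule.span ℝ (x '' I)) = I.card := by
  have := finrank_span_eq_card (h I hI).linearIndependent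
  rw [Set.image_eq_range]
  simpa using this

lemma GenPos.finrank_orth {ι : Type} {d : ℕ} {x : ι → E d} (h : GenPos d x)
    {I : Finset ι} (hI : I.card ≤ d) : Module.finrank ℝ (orth x I) = d - I.card := by
  have h1 := Submodule.finrank_add_finrank_orthogonal (Submodule.span ℝ (x '' (I : Set ι)))
  rw [h.finrank_span hI, finrank_euclideanSpace_fin] at h1
  unfold orth
  omega

/-- The functionals `⟪x j, ·⟫`, `j ∉ I`, on the orthogonal complement of the `x i`, `i ∈ I`. -/
def orthFunctional {ι : Type} {d : ℕ} (x : ι → E d) (I : Finset ι) (j : {j // j ∉ I}) :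
    Module.Dual ℝ (orth x I) :=
  (innerₛₗ ℝ (x j)).domRestrict (orth x I)

lemma orthFunctional_apply {ι : Type} {d : ℕ} (x : ι → E d) (I : Finset ι) (j : {j // j ∉ I})
    (y : orth x I) : orthFunctional x I j y = ⟪x j, (y : E d)⟫ := rfl

/-- A combination of the `x j` that vanishes on `orth x I` lies in the double orthogonal complement,
hence in the span of the `x i`, `i ∈ I`. Moving it to one side gives a relation among at most `d` of
the vectors. -/
lemma GenPos.orthFunctional {ι : Type} {d : ℕ} {x : ι → E d} (h : GenPos d x)
    {I : Finset ι} (hI : I.card ≤ d) : GenPos (d - I.card) (orthFunctional x I) := by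
  classical
  intro S hS
  rw [linearIndepOn_finset_iff]
  intro c hc
  have hmem : ∑ j ∈ S, c j • x j ∈ Submodule.span ℝ (x '' (I : Set ι)) := by
    rw [← Submodule.orthogonal_orthogonal (Submodule.span ℝ (x '' (I : Set ι))),
      Submodule.mem_orthogonal']
    intro y hy
    have := LinearMap.congr_fun hc ⟨y, hy⟩
    simpa [LinearMap.sum_apply, orthFunctional_apply, sum_inner, real_inner_smul_left] using this
  obtain ⟨a, ha⟩ := (Submodule.mem_span_image_finset_iff_exists_fun' ℝ).1 hmem
  have hdisj : Disjoint I (S.map (Function.Embedding.subtype _)) := by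
    rw [Finset.disjoint_left]
    intro i hi hi'
    obtain ⟨j, -, rfl⟩ := Finset.mem_map.1 hi'
    exact j.2 hi
  have hli := h (I ∪ S.map (Function.Embedding.subtype _)) (by
    rw [Finset.card_union_of_disjoint hdisj, Finset.card_map]; omega)
  rw [linearIndepOn_finset_iff] at hli
  have hsum : ∑ i ∈ I ∪ S.map (Function.Embedding.subtype _),
      (if hi : i ∈ I then -a i else c ⟨i, hi⟩) • x i = 0 := by
    have e1 : ∑ i ∈ I, (if hi : i ∈ I then -a i else c ⟨i, hi⟩) • x i = -∑ i ∈ I, a i • x i := by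
      rw [← Finset.sum_neg_distrib]
      exact Finset.sum_congr rfl fun i hi => by rw [dif_pos hi, neg_smul]
    have e2 : ∑ j ∈ S, (if hi : (j : ι) ∈ I then -a j else c ⟨j, hi⟩) • x j =
        ∑ j ∈ S, c j • x j :=
      Finset.sum_congr rfl fun j _ => by rw [dif_neg j.2]
    rw [Finset.sum_union hdisj, Finset.sum_map, e1, ha]
    exact (congrArg _ e2).trans (neg_add_cancel _)
  intro j hj
  have := hli _ hsum j (Finset.mem_union_right _ (Finset.mem_map.2 ⟨j, hj, rfl⟩))
  rwa [dif_neg j.2] at this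

open Classical in
/-- The number of sign vectors off `I` that are attained strictly on the orthogonal complement of
the `x i`, `i ∈ I`. -/
lemma GenPos.sum_feasible {ι : Type} [Fintype ι] {d : ℕ} {x : ι → E d} (h : GenPos d x)
    {I : Finset ι} (hI : I.card ≤ d) :
    ∑ ε : {j // j ∉ I} → Bool, (if Feasible (RandomCones.orthFunctional x I) ε then 1 else 0) =
      schlafliNumber ((Fintype.card ι : ℤ) - I.card) (d - I.card) := by
  rw [← feasibleCount_eq_sum, feasibleCount_eq _ (by
    rw [h.finrank_orth hI]; exact h.orthFunctional hI),
    h.finrank_orth hI]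
  congr 1
  have := Finset.card_le_univ I
  rw [Fintype.card_subtype_compl, Fintype.card_coe]
  push_cast [this]
  rfl

/-- The signs on `I` drop out because zero inner products are insensitive to sign. This turns
counting supported sets into counting cells in `orth x I`. -/
lemma supportedOn_signed_iff {ι : Type} {d : ℕ} (x : ι → E d) (I : Finset ι) (ε : ι → Bool) :
    SupportedOn (signed ε x) I ↔ Feasible (RandomCones.orthFunctional x I) (fun j => ε j) := by
  simp [SupportedOn, signed, Feasible, orthFunctional_apply, mem_orth, real_inner_smul_left,
    sgn_ne_zero]

/-! ### Faces of full dimension and angles -/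

lemma exists_sub_of_mem_span {d : ℕ} (C : PointedCone ℝ (E d)) {z : E d}
    (hz : z ∈ Submodule.span ℝ (C : Set (E d))) : ∃ a ∈ C, ∃ b ∈ C, z = a - b := by
  induction hz using Submodule.span_induction with
  | mem z hz => exact ⟨z, hz, 0, C.zero_mem, by simp⟩
  | zero => exact ⟨0, C.zero_mem, 0, C.zero_mem, by simp⟩
  | add y z _ _ hy hz =>
    obtain ⟨a, ha, b, hb, rfl⟩ := hy
    obtain ⟨a', ha', b', hb', rfl⟩ := hz
    exact ⟨a + a', C.add_mem ha ha', b + b', C.add_mem hb hb', by abel⟩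
  | smul t z _ hz =>
    obtain ⟨a, ha, b, hb, rfl⟩ := hz
    rcases le_total 0 t with ht | ht
    · exact ⟨t • a, PointedCone.smul_mem C ht ha, t • b, PointedCone.smul_mem C ht hb,
        smul_sub _ _ _⟩
    · exact ⟨(-t) • b, PointedCone.smul_mem C (neg_nonneg.2 ht) hb, (-t) • a,
        PointedCone.smul_mem C (neg_nonneg.2 ht) ha, by module⟩

/-- A face `G` of full dimension has the same span as `F`, so each `z ∈ F` is `a - b` with `a, b ∈
G`; from `z + b = a ∈ G` the face property gives `z ∈ G`. -/
lemma kFaces_coneDim {d : ℕ} (F : PointedCone ℝ (E d)) : kFaces (coneDim F) F = {F} := by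
  ext G
  simp only [kFaces, Set.mem_ofPred_eq, Set.mem_singleton_iff]
  refine ⟨fun ⟨hG, hd⟩ => le_antisymm hG.le fun z hz => ?_, fun h => h ▸ ⟨.rfl, rfl⟩⟩
  have hspan : Submodule.span ℝ (G : Set (E d)) = Submodule.span ℝ (F : Set (E d)) :=
    Submodule.eq_of_le_of_finrank_eq (Submodule.span_mono hG.le) hd
  obtain ⟨a, ha, b, hb, rfl⟩ := exists_sub_of_mem_span G
    (hspan ▸ Submodule.subset_span hz : z ∈ Submodule.span ℝ (G : Set (E d)))
  exact hG.mem_of_add_mem_left hz (hG.le hb) (by simpa using ha)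

lemma angle_ofSubmodule {d : ℕ} (L : Submodule ℝ (E d)) : angle (L : PointedCone ℝ (E d)) = 1 := by
  unfold angle
  split_ifs with h
  · rfl
  · have hL : Submodule.span ℝ ((L : PointedCone ℝ (E d)) : Set (E d)) = L := by
      rw [PointedCone.coe_ofSubmodule, Submodule.span_eq]
    have huniv :
        {u : Metric.sphere (0 : Submodule.span ℝ ((L : PointedCone ℝ (E d)) : Set (E d))) 1 |
        (u.1 : E d) ∈ (L : PointedCone ℝ (E d))} = Set.univ := by
      ext u
      simp only [Set.mem_ofPred_eq, Set.mem_univ, iff_true]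
      exact hL.le u.1.2
    rw [huniv]
    refine div_self ?_
    rw [Measure.toSphere_real_apply_univ]
    refine mul_ne_zero (by exact_mod_cast h) ?_
    exact (ENNReal.toReal_pos (Metric.measure_ball_pos _ _ one_pos).ne' measure_ball_lt_top.ne).ne'

lemma normalCone_self {d : ℕ} (F : PointedCone ℝ (E d)) :
    normalCone F F = ((Submodule.span ℝ (F : Set (E d)))ᗮ : Submodule ℝ (E d)) := by
  ext y
  change ((∀ x ∈ F, ⟪y, x⟫ ≤ 0) ∧ ∀ x ∈ F, ⟪y, x⟫ = 0) ↔ y ∈ (Submodule.span ℝ (F : Set (E d)))ᗮ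
  rw [Submodule.mem_orthogonal']
  refine ⟨fun h u hu => ?_, fun h => ⟨fun x hx => (h x (Submodule.subset_span hx)).le,
    fun x hx => h x (Submodule.subset_span hx)⟩⟩
  obtain ⟨a, ha, b, hb, rfl⟩ := exists_sub_of_mem_span F hu
  rw [inner_sub_right, h.2 a ha, h.2 b hb, sub_zero]

lemma intrinsicVolume_coneDim {d : ℕ} (F : PointedCone ℝ (E d)) :
    intrinsicVolume (coneDim F) F = angle F := by
  rw [intrinsicVolume, kFaces_coneDim, finsum_mem_singleton, extAngle, normalCone_self,
    angle_ofSubmodule, mul_one]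

lemma faceContent_eq {d : ℕ} (k : ℕ) (C : PointedCone ℝ (E d)) :
    faceContent k C = ∑ᶠ F ∈ kFaces k C, angle F :=
  finsum_mem_congr rfl fun F hF => by rw [← hF.2, intrinsicVolume_coneDim]

/-- The spherical measure of a set is the dimension times the volume of the cone over it inside the
unit ball; the dimension cancels in the ratio. -/
lemma angle_eq_volume {d : ℕ} (C : PointedCone ℝ (E d)) (h : coneDim C ≠ 0)
    (hm : MeasurableSet {u : Submodule.span ℝ (C : Set (E d)) | (u : E d) ∈ C}) :
    angle C = (volume : Measure (Submodule.span ℝ (C : Set (E d)))).real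
        {u | (u : E d) ∈ C ∧ ‖u‖ < 1} /
      (volume : Measure (Submodule.span ℝ (C : Set (E d)))).real {u | ‖u‖ < 1} := by
  have hne : Nontrivial (Submodule.span ℝ (C : Set (E d))) :=
    Module.nontrivial_of_finrank_pos (R := ℝ) (Nat.pos_of_ne_zero h)
  have hs : MeasurableSet {u : Metric.sphere (0 : Submodule.span ℝ (C : Set (E d))) 1 |
      (u.1 : E d) ∈ C} :=
    (measurable_subtype_coe : Measurable (Subtype.val : Metric.sphere
      (0 : Submodule.span ℝ (C : Set (E d))) 1 → _)) hm
  rw [angle, if_neg h, Measure.toSphere_real_apply_univ, measureReal_def,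
    Measure.toSphere_apply' _ hs, ENNReal.toReal_mul, ENNReal.toReal_natCast]
  have hball : Metric.ball (0 : Submodule.span ℝ (C : Set (E d))) 1 = {u | ‖u‖ < 1} := by
    ext; simp
  rw [hball, mul_div_mul_left _ _ (by exact_mod_cast h), ← measureReal_def]
  congr 1
  -- The cone over the spherical set omits only the origin, a null set as the span is nontrivial.
  open Pointwise in
  have hset : Set.Ioo (0 : ℝ) 1 • (Subtype.val '' {u : Metric.sphere
      (0 : Submodule.span ℝ (C : Set (E d))) 1 | (u.1 : E d) ∈ C}) =
      {u : Submodule.span ℝ (C : Set (E d)) | (u : E d) ∈ C ∧ ‖u‖ < 1} \ {0} := by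
    ext u
    simp only [Set.mem_smul, Set.mem_image, Set.mem_ofPred_eq, Set.mem_sdiff, Set.mem_singleton_iff]
    constructor
    · rintro ⟨t, ⟨ht0, ht1⟩, _, ⟨v, hv, rfl⟩, rfl⟩
      have hv1 : ‖v.1‖ = 1 := by simp
      refine ⟨⟨?_, ?_⟩, ?_⟩
      · exact PointedCone.smul_mem C ht0.le hv
      · rw [norm_smul, hv1, mul_one, Real.norm_of_nonneg ht0.le]
        exact ht1
      · rw [smul_eq_zero, not_or]
        refine ⟨ht0.ne', fun h => ?_⟩
        rw [h] at hv1
        simp at hv1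
    · rintro ⟨⟨hC, h1⟩, h0⟩
      have hpos : 0 < ‖u‖ := norm_pos_iff.2 h0
      refine ⟨‖u‖, ⟨hpos, h1⟩, ‖u‖⁻¹ • u, ⟨⟨‖u‖⁻¹ • u, ?_⟩, ?_, rfl⟩, ?_⟩
      · rw [mem_sphere_zero_iff_norm, norm_smul, norm_inv, norm_norm, inv_mul_cancel₀ hpos.ne']
      · exact PointedCone.smul_mem C (inv_nonneg.2 hpos.le) hC
      · rw [smul_inv_smul₀ hpos.ne']
  rw [hset, measureReal_def, measureReal_def, measure_sdiff_null (measure_singleton _)]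

/-- A linear isomorphism carries Haar measure to a constant multiple of Lebesgue measure, and the
constant cancels. Angles can thus be computed in a coordinate space that does not depend on the
cone. -/
lemma angle_eq_of_linearEquiv {d : ℕ} {V : Type*} [NormedAddCommGroup V] [NormedSpace ℝ V]
    [FiniteDimensional ℝ V] [MeasurableSpace V] [BorelSpace V] (μ : Measure V) [μ.IsAddHaarMeasure]
    {C : PointedCone ℝ (E d)} (h : coneDim C ≠ 0)
    (e : V ≃ₗ[ℝ] Submodule.span ℝ (C : Set (E d))) (hm : MeasurableSet {a : V | (e a : E d) ∈ C}) :
    angle C = μ.real {a | (e a : E d) ∈ C ∧ ‖(e a : E d)‖ < 1} /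
      μ.real {a | ‖(e a : E d)‖ < 1} := by
  have hcont : Continuous e := e.toContinuousLinearEquiv.continuous
  have hcont' : Continuous e.symm := e.symm.toContinuousLinearEquiv.continuous
  have hm' : MeasurableSet {u : Submodule.span ℝ (C : Set (E d)) | (u : E d) ∈ C} := by
    have := hcont'.measurable hm
    simpa using this
  have hball : MeasurableSet {u : Submodule.span ℝ (C : Set (E d)) | ‖u‖ < 1} :=
    (isOpen_lt continuous_norm continuous_const).measurableSet
  rw [angle_eq_volume C h hm']
  obtain ⟨c, hc, hc', hvol⟩ : ∃ c : ENNReal, c ≠ 0 ∧ c ≠ ⊤ ∧ μ.map e = c • volume := by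
    have h1 := Measure.isAddLeftInvariant_eq_smul (μ.map e) volume
    exact ⟨_, by exact_mod_cast (Measure.addHaarScalarFactor_pos_of_isAddHaarMeasure _ _).ne',
      ENNReal.coe_ne_top, h1⟩
  have key : ∀ s : Set (Submodule.span ℝ (C : Set (E d))), MeasurableSet s →
      μ.real (e ⁻¹' s) = c.toReal * (volume : Measure _).real s := by
    intro s hs
    rw [measureReal_def, ← Measure.map_apply hcont.measurable hs, hvol, Measure.smul_apply,
      smul_eq_mul, ENNReal.toReal_mul, measureReal_def]
  have k1 := key _ (hm'.inter hball)
  have k2 := key _ hball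
  have hc0 : c.toReal ≠ 0 := (ENNReal.toReal_pos hc hc').ne'
  change _ = μ.real (e ⁻¹' ({u | (u : E d) ∈ C} ∩ {u | ‖u‖ < 1})) / μ.real (e ⁻¹' {u | ‖u‖ < 1})
  rw [k1, k2, mul_div_mul_left _ _ hc0]
  rfl

/-! ### Tilings by the cells of an arrangement -/

lemma sum_mul_sum_sign {ι : Type} [Fintype ι] [DecidableEq ι] (I : Finset ι)
    (g : ({i // i ∈ I} → Bool) → ℝ) (f : ({j // j ∉ I} → Bool) → ℝ) :
    ∑ ε : ι → Bool, g (fun i => ε i) * f (fun j => ε j) = (∑ ε, g ε) * ∑ ε, f ε := by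
  let e : (ι → Bool) ≃ ({i // i ∈ I} → Bool) × ({j // j ∉ I} → Bool) :=
    Equiv.piEquivPiSubtypeProd (fun i => i ∈ I) (fun _ => Bool)
  rw [Finset.sum_mul_sum, ← Fintype.sum_prod_type' (f := fun a b => g a * f b), ← e.sum_comp]
  rfl

lemma sum_sign_compl {ι : Type} [Fintype ι] [DecidableEq ι] (I : Finset ι)
    (f : ({j // j ∉ I} → Bool) → ℝ) :
    ∑ ε : ι → Bool, f (fun j => ε j) = 2 ^ I.card * ∑ ε, f ε := by
  have := sum_mul_sum_sign I (fun _ => 1) f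
  simpa using this

section Tiling

variable {J V : Type*} [Fintype J] [NormedAddCommGroup V] [NormedSpace ℝ V] [FiniteDimensional ℝ V]
  [MeasurableSpace V] [BorelSpace V] (μ : Measure V) [μ.IsAddHaarMeasure]

lemma measurableSet_signCell (g : J → Module.Dual ℝ V) (ε : J → Bool) :
    MeasurableSet {y | ∀ j, 0 ≤ sgn (ε j) * g j y} := by
  rw [Set.ofPred_forall]
  refine MeasurableSet.iInter fun j => ?_
  exact (isClosed_le continuous_const
    (continuous_const.mul (LinearMap.continuous_of_finiteDimensional (g j)))).measurableSet

lemma measure_ker_eq_zero {g : Module.Dual ℝ V} (hg : g ≠ 0) : μ {y | g y = 0} = 0 :=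
  Measure.addHaar_submodule μ (LinearMap.ker g) fun h => hg (LinearMap.ker_eq_top.1 h)

/-- A closed cell without strict points lies in the union of the hyperplanes. -/
lemma measure_signCell_eq_zero {g : J → Module.Dual ℝ V} (hg : ∀ j, g j ≠ 0) {ε : J → Bool}
    (hε : ¬ Feasible g ε) : μ {y | ∀ j, 0 ≤ sgn (ε j) * g j y} = 0 := by
  refine measure_mono_null (t := ⋃ j, {y | g j y = 0}) (fun y hy => ?_)
    (measure_iUnion_null fun j => measure_ker_eq_zero μ (hg j))
  by_contra hne
  simp only [Set.mem_iUnion, Set.mem_ofPred_eq, not_exists] at hne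
  exact hε ⟨y, fun j => lt_of_le_of_ne (hy j) (mul_ne_zero (sgn_ne_zero _) (hne j)).symm⟩

/-- The closed cells cover the space, and two different ones overlap only inside a hyperplane. -/
lemma sum_measureReal_signCell [DecidableEq J] {g : J → Module.Dual ℝ V} (hg : ∀ j, g j ≠ 0)
    {B : Set V} (hB : MeasurableSet B) (hB' : μ B ≠ ⊤) :
    ∑ ε : J → Bool, μ.real ({y | ∀ j, 0 ≤ sgn (ε j) * g j y} ∩ B) = μ.real B := by
  have hU : B = ⋃ ε : J → Bool, ({y | ∀ j, 0 ≤ sgn (ε j) * g j y} ∩ B) := by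
    ext y
    simp only [Set.mem_iUnion, Set.mem_inter_iff, Set.mem_ofPred_eq, exists_and_right]
    refine ⟨fun hy => ⟨⟨fun j => decide (0 ≤ g j y), fun j => ?_⟩, hy⟩, fun h => h.2⟩
    by_cases h : 0 ≤ g j y
    · simp [h]
    · simp [h]
      exact (not_le.1 h).le
  have hd : Pairwise (Function.onFun (AEDisjoint μ)
      fun ε : J → Bool => ({y | ∀ j, 0 ≤ sgn (ε j) * g j y} ∩ B)) := by
    intro ε ε' hne
    obtain ⟨j, hj⟩ := Function.ne_iff.1 hne
    refine measure_mono_null (fun y hy => ?_) (measure_ker_eq_zero μ (hg j))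
    have h1 := hy.1.1 j
    have h2 := hy.2.1 j
    change g j y = 0
    cases h : ε j <;> cases h' : ε' j <;> simp [h, h'] at hj h1 h2 <;> linarith
  have hsum := measure_iUnion₀ hd
    (fun ε => ((measurableSet_signCell g ε).inter hB).nullMeasurableSet)
  rw [← hU, tsum_fintype] at hsum
  rw [measureReal_def, hsum, ENNReal.toReal_sum]
  · rfl
  · exact fun ε _ => measure_ne_top_of_subset Set.inter_subset_right hB'

end Tiling

/-! ### Angles of simplicial cones -/

/-- The positive hull of the `x i`, `i ∈ I`. -/
def faceCone {ι : Type} {d : ℕ} (x : ι → E d) (I : Finset ι) : PointedCone ℝ (E d) :=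
  PointedCone.hull ℝ (x '' I)

lemma span_faceCone {ι : Type} {d : ℕ} (x : ι → E d) (I : Finset ι) :
    Submodule.span ℝ (faceCone x I : Set (E d)) = Submodule.span ℝ (x '' I) :=
  le_antisymm (Submodule.span_le.2 (PointedCone.hull_le_span ℝ _))
    (Submodule.span_mono PointedCone.subset_hull)

lemma mem_faceCone {ι : Type} {d : ℕ} {x : ι → E d} {I : Finset ι} {y : E d} :
    y ∈ faceCone x I ↔ ∃ a : {i // i ∈ I} → ℝ, (∀ i, 0 ≤ a i) ∧ ∑ i, a i • x i = y := by
  have : (x '' (I : Set ι)) = Set.range (fun i : {i // i ∈ I} => x i) := by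
    rw [Set.image_eq_range]; rfl
  rw [faceCone, this, PointedCone.hull, Submodule.mem_span_range_iff_exists_fun]
  constructor
  · rintro ⟨c, rfl⟩
    exact ⟨fun i => c i, fun i => (c i).2, rfl⟩
  · rintro ⟨a, ha, rfl⟩
    exact ⟨fun i => ⟨a i, ha i⟩, rfl⟩

lemma angle_eq_of_linearEquiv' {d : ℕ} {V : Type*} [NormedAddCommGroup V] [NormedSpace ℝ V]
    [FiniteDimensional ℝ V] [MeasurableSpace V] [BorelSpace V] (μ : Measure V) [μ.IsAddHaarMeasure]
    {C : PointedCone ℝ (E d)} {L : Submodule ℝ (E d)}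
    (hL : Submodule.span ℝ (C : Set (E d)) = L) (h : Module.finrank ℝ L ≠ 0)
    (e : V ≃ₗ[ℝ] L) (hm : MeasurableSet {a : V | (e a : E d) ∈ C}) :
    angle C = μ.real ({a | (e a : E d) ∈ C} ∩ {a | ‖(e a : E d)‖ < 1}) /
      μ.real {a | ‖(e a : E d)‖ < 1} := by
  subst hL
  exact angle_eq_of_linearEquiv μ h e hm

/-- The parametrization of the linear hull of linearly independent vectors. -/
def spanEquiv {ι : Type} {d : ℕ} {x : ι → E d} {I : Finset ι}
    (h : LinearIndepOn ℝ x (I : Set ι)) :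
    ({i // i ∈ I} → ℝ) ≃ₗ[ℝ] Submodule.span ℝ (x '' I) :=
  (Module.Basis.span h.linearIndependent).equivFun.symm.trans
    (LinearEquiv.ofEq _ _ (by rw [Set.image_eq_range]))

lemma coe_spanEquiv {ι : Type} {d : ℕ} {x : ι → E d} {I : Finset ι}
    (h : LinearIndepOn ℝ x (I : Set ι)) (a : {i // i ∈ I} → ℝ) :
    (spanEquiv h a : E d) = ∑ i, a i • x i := by
  rw [spanEquiv, LinearEquiv.trans_apply, LinearEquiv.coe_ofEq_apply,
    Module.Basis.equivFun_symm_apply, Submodule.coe_sum]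
  refine Finset.sum_congr rfl fun i _ => ?_
  rw [Submodule.coe_smul, Module.Basis.coe_span_apply]

/-- The proportion of the orthant of signs `ε` in the ellipsoid `{a | ‖∑ i, a i • x i‖ < 1}`. -/
def orthantRatio {ι : Type} {d : ℕ} (x : ι → E d) (I : Finset ι) (ε : {i // i ∈ I} → Bool) : ℝ :=
  (volume : Measure ({i // i ∈ I} → ℝ)).real
      ({a | ∀ i, 0 ≤ sgn (ε i) * a i} ∩ {a | ‖∑ i, a i • x i‖ < 1}) /
    (volume : Measure ({i // i ∈ I} → ℝ)).real {a | ‖∑ i, a i • x i‖ < 1}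

lemma span_signed_image {ι : Type} {d : ℕ} (x : ι → E d) (I : Finset ι) (ε : ι → Bool) :
    Submodule.span ℝ (signed ε x '' I) = Submodule.span ℝ (x '' I) := by
  refine le_antisymm (Submodule.span_le.2 ?_) (Submodule.span_le.2 ?_)
  · rintro _ ⟨i, hi, rfl⟩
    exact Submodule.smul_mem _ _ (Submodule.subset_span ⟨i, hi, rfl⟩)
  · rintro _ ⟨i, hi, rfl⟩
    have : x i = sgn (ε i) • signed ε x i := by rw [signed, smul_smul, sgn_mul_self, one_smul]
    rw [SetLike.mem_coe, this]
    exact Submodule.smul_mem _ _ (Submodule.subset_span ⟨i, hi, rfl⟩)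

/-- Coordinates are taken with respect to the unsigned `x i` for every `ε`: the ellipsoid is then
common to all sign choices, and the cone becomes an orthant. -/
lemma angle_faceCone_signed {ι : Type} {d : ℕ} {x : ι → E d} {I : Finset ι}
    (h : LinearIndepOn ℝ x (I : Set ι)) (hI : I.Nonempty) (ε : ι → Bool) :
    angle (faceCone (signed ε x) I) = orthantRatio x I (fun i => ε i) := by
  have hset : {a | (spanEquiv h a : E d) ∈ faceCone (signed ε x) I} =
      {a | ∀ i : {i // i ∈ I}, 0 ≤ sgn (ε i) * a i} := by
    ext a
    rw [Set.mem_ofPred_eq, Set.mem_ofPred_eq, mem_faceCone]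
    constructor
    · rintro ⟨b, hb, hab⟩ i
      have hb' : spanEquiv h (fun i => b i * sgn (ε i)) = spanEquiv h a := by
        apply Subtype.ext
        rw [← hab, coe_spanEquiv]
        simp [signed, smul_smul]
      rw [← (spanEquiv h).injective hb']
      have := mul_nonneg (hb i) (mul_self_nonneg (sgn (ε i)))
      linarith
    · intro ha
      refine ⟨fun i => sgn (ε i) * a i, ha, ?_⟩
      rw [coe_spanEquiv]
      refine Finset.sum_congr rfl fun i _ => ?_
      rw [signed, smul_smul, mul_right_comm, sgn_mul_self, one_mul]
  have hm : MeasurableSet {a : {i // i ∈ I} → ℝ | ∀ i : {i // i ∈ I}, 0 ≤ sgn (ε i) * a i} :=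
    measurableSet_signCell (V := {i // i ∈ I} → ℝ) (fun i => LinearMap.proj i) (fun i => ε i)
  rw [angle_eq_of_linearEquiv' volume (L := Submodule.span ℝ (x '' I))
    (by rw [span_faceCone, span_signed_image])
    (by
      have := finrank_span_eq_card h.linearIndependent
      rw [Set.image_eq_range]
      rw [this]
      simpa using hI.ne_empty)
    (spanEquiv h) (by rw [hset]; exact hm), hset]
  simp only [coe_spanEquiv]
  rfl

lemma sum_orthantRatio {ι : Type} [DecidableEq ι] {d : ℕ} {x : ι → E d} {I : Finset ι}
    (h : LinearIndepOn ℝ x (I : Set ι)) :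
    ∑ ε : {i // i ∈ I} → Bool, orthantRatio x I ε = 1 := by
  have hc : Continuous fun a : {i // i ∈ I} → ℝ => ‖∑ i, a i • x i‖ := by fun_prop
  have hopen : IsOpen {a : {i // i ∈ I} → ℝ | ‖∑ i, a i • x i‖ < 1} :=
    isOpen_lt hc continuous_const
  -- Linear independence makes the ellipsoid bounded, so that its volume is finite.
  have hbdd : Bornology.IsBounded {a : {i // i ∈ I} → ℝ | ‖∑ i, a i • x i‖ < 1} := by
    let e := (spanEquiv h).toContinuousLinearEquiv
    have : {a : {i // i ∈ I} → ℝ | ‖∑ i, a i • x i‖ < 1} ⊆ e.symm '' Metric.ball 0 1 := by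
      intro a ha
      refine ⟨e a, ?_, e.symm_apply_apply a⟩
      rw [mem_ball_zero_iff]
      change ‖(spanEquiv h a : E d)‖ < 1
      rw [coe_spanEquiv]
      exact ha
    exact (e.symm.lipschitz.isBounded_image Metric.isBounded_ball).subset this
  unfold orthantRatio
  rw [← Finset.sum_div]
  have := sum_measureReal_signCell (volume : Measure ({i // i ∈ I} → ℝ))
    (g := fun i => LinearMap.proj i) (fun i hi => ?_) hopen.measurableSet hbdd.measure_lt_top.ne
  · simp only [LinearMap.proj_apply] at this
    rw [this]
    refine div_self (ENNReal.toReal_pos (hopen.measure_ne_zero _ ⟨0, by simp⟩)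
      hbdd.measure_lt_top.ne).ne'
  · have := LinearMap.congr_fun hi (Pi.single i 1)
    simp at this

/-! ### Counting supported sets -/

open Classical in
lemma GenPos.sum_feasible_orthFunctional {ι : Type} [Fintype ι] [DecidableEq ι] {d : ℕ}
    {x : ι → E d} (h : GenPos d x) {I : Finset ι} (hI : I.card ≤ d) :
    ∑ ε : {j // j ∉ I} → Bool,
        (if Feasible (RandomCones.orthFunctional x I) ε then (1 : ℝ) else 0) =
      schlafliNumber ((Fintype.card ι : ℤ) - I.card) (d - I.card) := by
  rw [← h.sum_feasible hI]
  push_cast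
  congr!

open Classical in
lemma GenPos.sum_supportedOn_empty {ι : Type} [Fintype ι] {d : ℕ} {x : ι → E d} (h : GenPos d x) :
    ∑ ε : ι → Bool, (if SupportedOn (RandomCones.signed ε x) ∅ then (1 : ℝ) else 0) =
      schlafliNumber (Fintype.card ι : ℤ) d := by
  have h1 := h.sum_feasible_orthFunctional (I := ∅) (by simp)
  have h2 := sum_sign_compl (∅ : Finset ι) fun ε =>
    if Feasible (RandomCones.orthFunctional x ∅) ε then (1 : ℝ) else 0
  simp only [Finset.card_empty, pow_zero, one_mul, Nat.cast_zero, sub_zero, Nat.sub_zero] at h1 h2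
  rw [← h1, ← h2]
  exact Finset.sum_congr rfl fun ε _ => if_congr (supportedOn_signed_iff x ∅ ε) rfl rfl

/-! ### Faces of intersections of halfspaces -/

lemma supportedOn_iff_neg {ι : Type} {d : ℕ} (u : ι → E d) (I : Finset ι) :
    SupportedOn u I ↔ ∃ y ∈ orth u I, ∀ i, i ∉ I → ⟪u i, y⟫ < 0 := by
  constructor
  · rintro ⟨y, h0, h1⟩
    exact ⟨-y, neg_mem (mem_orth.2 h0), fun i hi => by simpa [inner_neg_right] using h1 i hi⟩
  · rintro ⟨y, h0, h1⟩
    exact ⟨-y, mem_orth.1 (neg_mem h0), fun i hi => by simpa [inner_neg_right] using h1 i hi⟩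

/-- The part of the cone `⋂ᵢ uᵢ⁻` that is orthogonal to the `u i`, `i ∈ I`. -/
def orthFace {d n : ℕ} (u : Fin n → E d) (I : Finset (Fin n)) : PointedCone ℝ (E d) :=
  halfspaceCone u ⊓ (orth u I : PointedCone ℝ (E d))

lemma mem_orthFace {d n : ℕ} {u : Fin n → E d} {I : Finset (Fin n)} {y : E d} :
    y ∈ orthFace u I ↔ y ∈ halfspaceCone u ∧ y ∈ orth u I := Iff.rfl

lemma orth_empty {ι : Type} {d : ℕ} (x : ι → E d) : orth x ∅ = ⊤ := by
  ext y
  simp [mem_orth]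

lemma orthFace_empty {d n : ℕ} (u : Fin n → E d) : orthFace u ∅ = halfspaceCone u := by
  ext y
  simp [mem_orthFace, mem_orth]

/-- The point `y` is relatively interior to `orthFace u I`, so one can move a little in both
directions along any `z` of `orth u I`. -/
lemma exists_add_smul_mem_halfspaceCone {d n : ℕ} {u : Fin n → E d} {I : Finset (Fin n)} {y z : E d}
    (hy : y ∈ orth u I) (hy' : ∀ i, i ∉ I → ⟪u i, y⟫ < 0) (hz : z ∈ orth u I) :
    ∃ t : ℝ, 0 < t ∧ y + t • z ∈ orthFace u I ∧ y - t • z ∈ orthFace u I := by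
  obtain ⟨t, ht, H⟩ := exists_pos_perturb (fun i : {i // i ∉ I} => -⟪u i, y⟫)
    (fun i => -⟪u i, z⟫) (fun i => neg_pos.2 (hy' i i.2))
  refine ⟨t, ht, ⟨fun i => ?_, (orth u I).add_mem hy ((orth u I).smul_mem _ hz)⟩,
    ⟨fun i => ?_, (orth u I).sub_mem hy ((orth u I).smul_mem _ hz)⟩⟩
  · rw [inner_add_right, real_inner_smul_right]
    by_cases hi : i ∈ I
    · rw [mem_orth.1 hy i hi, mem_orth.1 hz i hi]; simp
    · have := (H ⟨i, hi⟩).1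
      simp only at this
      linarith
  · rw [inner_sub_right, real_inner_smul_right]
    by_cases hi : i ∈ I
    · rw [mem_orth.1 hy i hi, mem_orth.1 hz i hi]; simp
    · have := (H ⟨i, hi⟩).2
      simp only at this
      linarith

lemma mem_orthFace_of_neg {d n : ℕ} {u : Fin n → E d} {I : Finset (Fin n)} {y : E d}
    (hy : y ∈ orth u I) (hy' : ∀ i, i ∉ I → ⟪u i, y⟫ < 0) : y ∈ orthFace u I := by
  refine ⟨fun i => ?_, hy⟩
  by_cases hi : i ∈ I
  · exact (mem_orth.1 hy i hi).le
  · exact (hy' i hi).le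

lemma span_orthFace {d n : ℕ} {u : Fin n → E d} {I : Finset (Fin n)} (h : SupportedOn u I) :
    Submodule.span ℝ (orthFace u I : Set (E d)) = orth u I := by
  obtain ⟨y, hy, hy'⟩ := (supportedOn_iff_neg u I).1 h
  refine le_antisymm (Submodule.span_le.2 fun z hz => hz.2) fun z hz => ?_
  obtain ⟨t, ht, h1, -⟩ := exists_add_smul_mem_halfspaceCone hy hy' hz
  have : z = t⁻¹ • ((y + t • z) - y) := by
    rw [add_sub_cancel_left, inv_smul_smul₀ ht.ne']
  rw [this]
  exact Submodule.smul_mem _ _ (sub_mem (Submodule.subset_span h1)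
    (Submodule.subset_span (mem_orthFace_of_neg hy hy')))

/-- Each constraint not identically active on `F` has a witness in `F` where it is strict; the sum
of the witnesses is strict for all of them. -/
lemma exists_mem_inner_neg {d n : ℕ} {u : Fin n → E d} {F : PointedCone ℝ (E d)}
    (hF : F ≤ halfspaceCone u) :
    ∃ y ∈ F, ∀ i, (∀ z ∈ F, ⟪u i, z⟫ = 0) ∨ ⟪u i, y⟫ < 0 := by
  have : ∀ i, ∃ z ∈ F, (∀ w ∈ F, ⟪u i, w⟫ = 0) ∨ ⟪u i, z⟫ < 0 := by
    intro i
    by_cases h : ∀ w ∈ F, ⟪u i, w⟫ = 0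
    · exact ⟨0, F.zero_mem, Or.inl h⟩
    · push Not at h
      obtain ⟨w, hw, hne⟩ := h
      exact ⟨w, hw, Or.inr (lt_of_le_of_ne (hF hw i) hne)⟩
  choose z hz hz' using this
  refine ⟨∑ j, z j, F.sum_mem fun j _ => hz j, fun i => (hz' i).imp id fun h => ?_⟩
  rw [inner_sum]
  exact Finset.sum_neg' (fun j _ => hF (hz j) i) ⟨i, Finset.mem_univ i, h⟩

lemma coneDim_halfspaceCone_eq_iff {d n : ℕ} {u : Fin n → E d} (hu : ∀ i, u i ≠ 0) :
    coneDim (halfspaceCone u) = d ↔ SupportedOn u ∅ := by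
  constructor
  · intro h
    obtain ⟨y, -, hy'⟩ := exists_mem_inner_neg (le_refl (halfspaceCone u))
    refine (supportedOn_iff_neg u ∅).2 ⟨y, by simp [mem_orth], fun i _ => (hy' i).resolve_left ?_⟩
    intro h0
    have htop : Submodule.span ℝ (halfspaceCone u : Set (E d)) = ⊤ :=
      Submodule.eq_top_of_finrank_eq (by rw [finrank_euclideanSpace_fin]; exact h)
    have hle : Submodule.span ℝ (halfspaceCone u : Set (E d)) ≤ (ℝ ∙ u i)ᗮ :=
      Submodule.span_le.2 fun z hz => Submodule.mem_orthogonal_singleton_iff_inner_right.2 (h0 z hz)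
    rw [htop] at hle
    have := Submodule.mem_orthogonal_singleton_iff_inner_right.1
      (hle (Submodule.mem_top (x := u i)))
    exact hu i (inner_self_eq_zero.1 this)
  · intro h
    have := span_orthFace h
    rw [orthFace_empty] at this
    rw [coneDim, this, orth_empty, finrank_top, finrank_euclideanSpace_fin]

lemma isFaceOf_orthFace {d n : ℕ} (u : Fin n → E d) (I : Finset (Fin n)) :
    (orthFace u I).IsFaceOf (halfspaceCone u) := by
  refine ⟨inf_le_left, fun {a b t} ha hb ht hab => ⟨ha, mem_orth.2 fun i hi => ?_⟩⟩
  have h0 := mem_orth.1 hab.2 i hi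
  rw [inner_add_right, real_inner_smul_right] at h0
  have h1 := ha i
  have h2 := hb i
  nlinarith

open Classical in
lemma exists_eq_orthFace {d n : ℕ} {u : Fin n → E d} {F : PointedCone ℝ (E d)}
    (hF : F.IsFaceOf (halfspaceCone u)) : ∃ I, SupportedOn u I ∧ F = orthFace u I := by
  obtain ⟨y, hy, hy'⟩ := exists_mem_inner_neg hF.le
  set I : Finset (Fin n) := Finset.univ.filter fun i => ∀ z ∈ F, ⟪u i, z⟫ = 0 with hI
  have hFI : ∀ z ∈ F, z ∈ orth u I := fun z hz => mem_orth.2 fun i hi =>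
    (Finset.mem_filter.1 hi).2 z hz
  have hneg : ∀ i, i ∉ I → ⟪u i, y⟫ < 0 := fun i hi =>
    (hy' i).resolve_left fun h => hi (Finset.mem_filter.2 ⟨Finset.mem_univ _, h⟩)
  refine ⟨I, (supportedOn_iff_neg u I).2 ⟨y, hFI y hy, hneg⟩,
    le_antisymm (fun z hz => ⟨hF.le hz, hFI z hz⟩) fun z hz => ?_⟩
  -- Now `y = t • z + (y - t • z)` lies in `F` with `z` and `y - t • z` in the cone, so the face
  -- property puts `z` in `F`.
  obtain ⟨t, ht, -, h2⟩ := exists_add_smul_mem_halfspaceCone (hFI y hy) hneg hz.2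
  exact hF.mem_of_smul_add_mem hz.1 h2.1 ht (by simpa using hy)

lemma orthFace_injOn {d n : ℕ} (u : Fin n → E d) :
    Set.InjOn (orthFace u) {I | SupportedOn u I} := by
  have key : ∀ I J, SupportedOn u I → orthFace u I = orthFace u J → J ⊆ I := by
    intro I J hI h i hi
    obtain ⟨y, hy, hy'⟩ := (supportedOn_iff_neg u I).1 hI
    by_contra hiI
    have hmem := mem_orthFace_of_neg hy hy'
    rw [h] at hmem
    exact (hy' i hiI).ne (mem_orth.1 hmem.2 i hi)
  exact fun I hI J hJ h => (key J I hJ h.symm).antisymm (key I J hI h)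

/-- Since `k ≥ 1`, sets of more than `d` indices are excluded: their orthogonal complement is
trivial. -/
lemma GenPos.card_eq_of_finrank_orth {ι : Type} {d k : ℕ} {u : ι → E d} (h : GenPos d u)
    {I : Finset ι} (hk : 1 ≤ k) (hI : Module.finrank ℝ (orth u I) = k) : I.card = d - k := by
  by_cases hc : I.card ≤ d
  · rw [h.finrank_orth hc] at hI
    omega
  · exfalso
    have : orth u I = ⊥ := by
      rw [eq_bot_iff]
      intro y hy
      exact (Submodule.mem_bot ℝ).2 (h.eq_zero_of_inner_eq_zero (not_le.1 hc).le (mem_orth.1 hy))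
    rw [this, finrank_bot] at hI
    omega

open Classical in
lemma GenPos.faceContent_halfspaceCone {d n k : ℕ} {u : Fin n → E d} (h : GenPos d u) (hk : 1 ≤ k)
    (hkd : k ≤ d) :
    faceContent k (halfspaceCone u) = ∑ I ∈ Finset.powersetCard (d - k) Finset.univ,
      if SupportedOn u I then angle (orthFace u I) else 0 := by
  rw [faceContent_eq, ← Finset.sum_filter]
  have hset : kFaces k (halfspaceCone u) = orthFace u '' ((Finset.powersetCard (d - k)
      Finset.univ).filter fun I => SupportedOn u I : Finset (Finset (Fin n))) := by
    ext F
    simp only [Set.mem_image, SetLike.mem_coe, Finset.mem_filter, Finset.mem_powersetCard,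
      Finset.subset_univ, true_and]
    constructor
    · rintro ⟨hF, hdim⟩
      obtain ⟨I, hI, rfl⟩ := exists_eq_orthFace hF
      rw [coneDim, span_orthFace hI] at hdim
      exact ⟨I, ⟨h.card_eq_of_finrank_orth hk hdim, hI⟩, rfl⟩
    · rintro ⟨I, ⟨hc, hI⟩, rfl⟩
      refine ⟨isFaceOf_orthFace u I, ?_⟩
      rw [coneDim, span_orthFace hI, h.finrank_orth (by omega)]
      omega
  rw [hset, finsum_mem_image, finsum_mem_coe_finset]
  exact (orthFace_injOn u).mono fun I hI => (Finset.mem_filter.1 hI).2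

lemma orth_signed {ι : Type} {d : ℕ} (x : ι → E d) (I : Finset ι) (ε : ι → Bool) :
    orth (signed ε x) I = orth x I := by
  rw [orth, orth, span_signed_image]

-- The supported sign vectors give the cells of the arrangement in `orth x I`, whose angles add up
-- to 1; the signs on `I` are free and contribute the factor `2 ^ I.card`.
open Classical in
lemma GenPos.sum_angle_orthFace {d n : ℕ} {x : Fin n → E d} (h : GenPos d x) {I : Finset (Fin n)}
    (hI : I.card < d) :
    ∑ ε : Fin n → Bool, (if SupportedOn (RandomCones.signed ε x) I then
      angle (orthFace (RandomCones.signed ε x) I) else 0) = 2 ^ I.card := by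
  -- The minus sign turns the halfspaces `⟪u i, y⟫ ≤ 0` into nonnegative sign cells.
  let g : {j // j ∉ I} → Module.Dual ℝ (orth x I) := fun j => -RandomCones.orthFunctional x I j
  have hg : ∀ j, g j ≠ 0 := by
    intro j hj
    have hne := (h.orthFunctional hI.le {j} (by simp; omega))
    rw [Finset.coe_singleton, linearIndepOn_singleton_iff] at hne
    exact hne (neg_eq_zero.1 hj)
  have hfeas : ∀ ε, Feasible g ε ↔ Feasible (RandomCones.orthFunctional x I) ε := by
    intro ε
    constructor <;> rintro ⟨y, hy⟩ <;> exact ⟨-y, fun j => by simpa [g] using hy j⟩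
  let B : Set (orth x I) := {y | ‖y‖ < 1}
  have hB : B = Metric.ball 0 1 := by ext; simp [B]
  have hBm : MeasurableSet B := hB ▸ measurableSet_ball
  have hBfin : (volume : Measure (orth x I)) B ≠ ⊤ := hB ▸ measure_ball_lt_top.ne
  have hBpos : (volume : Measure (orth x I)).real B ≠ 0 :=
    (ENNReal.toReal_pos (hB ▸ (Metric.measure_ball_pos _ _ one_pos).ne') hBfin).ne'
  -- The volume ratio also covers unsupported `ε`, since an infeasible cell is null.
  have hterm : ∀ ε : Fin n → Bool, (if SupportedOn (RandomCones.signed ε x) I then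
      angle (orthFace (RandomCones.signed ε x) I) else 0) =
      (volume : Measure (orth x I)).real ({y | ∀ j : {j // j ∉ I}, 0 ≤ sgn (ε j) * g j y} ∩ B) /
        (volume : Measure (orth x I)).real B := by
    intro ε
    split_ifs with hs
    · have hset : {y : orth x I | (y : E d) ∈ orthFace (RandomCones.signed ε x) I} =
          {y | ∀ j : {j // j ∉ I}, 0 ≤ sgn (ε j) * g j y} := by
        ext y
        rw [Set.mem_ofPred_eq, Set.mem_ofPred_eq, mem_orthFace, orth_signed, and_iff_left y.2]
        constructor
        · intro hy j
          have := hy j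
          rw [RandomCones.signed, real_inner_smul_left] at this
          simpa [g, orthFunctional_apply] using this
        · intro hy i
          rw [RandomCones.signed, real_inner_smul_left]
          by_cases hi : i ∈ I
          · rw [mem_orth.1 y.2 i hi, mul_zero]
          · simpa [g, orthFunctional_apply] using hy ⟨i, hi⟩
      have hm := measurableSet_signCell g fun j => ε j
      rw [angle_eq_of_linearEquiv' volume (L := orth x I)
        (by rw [span_orthFace hs, orth_signed]) (by rw [h.finrank_orth hI.le]; omega)
        (LinearEquiv.refl ℝ _) (by simp only [LinearEquiv.refl_apply]; rw [hset]; exact hm)]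
      simp only [LinearEquiv.refl_apply]
      rw [hset]
      rfl
    · rw [supportedOn_signed_iff, ← hfeas] at hs
      rw [measureReal_def, measure_mono_null Set.inter_subset_left
        (measure_signCell_eq_zero volume hg hs)]
      simp
  rw [Finset.sum_congr rfl fun ε _ => hterm ε, sum_sign_compl I (fun ε =>
    (volume : Measure (orth x I)).real ({y | ∀ j, 0 ≤ sgn (ε j) * g j y} ∩ B) /
      (volume : Measure (orth x I)).real B), ← Finset.sum_div,
    sum_measureReal_signCell volume hg hBm hBfin, div_self hBpos, mul_one]

/-! ### Means over Schläfli cones -/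

/-- A normal of `H i` is a nonzero multiple of `x i`, and only the sign of the factor affects the
halfspace. -/
lemma schlafliCones_eq {d n : ℕ} {H : Fin n → Grassmannian d (d - 1)} {x : Fin n → E d}
    (hx : ∀ i, (H i).1ᗮ = ℝ ∙ x i) (hx0 : ∀ i, x i ≠ 0) :
    schlafliCones H =
      (fun ε => halfspaceCone (signed ε x)) '' {ε | SupportedOn (signed ε x) ∅} := by
  have hne : ∀ ε i, signed ε x i ≠ 0 := fun ε i => smul_ne_zero (sgn_ne_zero _) (hx0 i)
  ext C
  constructor
  · rintro ⟨⟨u, hu, rfl⟩, hdim⟩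
    have : ∀ i, ∃ b : Bool, ∃ c : ℝ, 0 < c ∧ u i = c • (sgn b • x i) := by
      intro i
      have h1 := (hu i).1
      rw [hx i, Submodule.mem_span_singleton] at h1
      obtain ⟨a, ha⟩ := h1
      have ha0 : a ≠ 0 := by
        rintro rfl
        exact (hu i).2 (by rw [← ha, zero_smul])
      rcases lt_or_gt_of_ne ha0 with h | h
      · exact ⟨false, -a, neg_pos.2 h, by rw [← ha]; simp⟩
      · exact ⟨true, a, h, by rw [← ha]; simp⟩
    choose ε c hc huc using this
    have hC : halfspaceCone u = halfspaceCone (signed ε x) := by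
      ext y
      refine forall_congr' fun i => ?_
      rw [huc i, real_inner_smul_left, signed]
      exact ⟨fun h => nonpos_of_mul_nonpos_right h (hc i), mul_nonpos_of_nonneg_of_nonpos (hc i).le⟩
    exact ⟨ε, (coneDim_halfspaceCone_eq_iff (hne ε)).1 (hC ▸ hdim), hC.symm⟩
  · rintro ⟨ε, hε, rfl⟩
    refine ⟨⟨signed ε x, fun i => ⟨?_, hne ε i⟩, rfl⟩, (coneDim_halfspaceCone_eq_iff (hne ε)).2 hε⟩
    rw [hx i]
    exact Submodule.smul_mem _ _ (Submodule.mem_span_singleton_self _)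

lemma halfspaceCone_signed_injOn {d n : ℕ} (x : Fin n → E d) :
    Set.InjOn (fun ε => halfspaceCone (signed ε x)) {ε | SupportedOn (signed ε x) ∅} := by
  intro ε hε ε' _ h
  obtain ⟨y, -, hy⟩ := (supportedOn_iff_neg _ _).1 hε
  have hmem : y ∈ halfspaceCone (signed ε x) := fun i => (hy i (by simp)).le
  have hmem' : y ∈ halfspaceCone (signed ε' x) := by
    change halfspaceCone (signed ε x) = halfspaceCone (signed ε' x) at h
    rwa [h] at hmem
  funext i
  have h1 := hy i (by simp)
  have h2 := hmem' i
  rw [signed, real_inner_smul_left] at h1 h2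
  cases hb : ε i <;> cases hb' : ε' i <;> simp [hb, hb'] at h1 h2 ⊢ <;> linarith

open Classical in
theorem GenPos.schlafliMean_faceContent {d n k : ℕ} {H : Fin n → Grassmannian d (d - 1)}
    {x : Fin n → E d} (h : GenPos d x) (hx : ∀ i, (H i).1ᗮ = ℝ ∙ x i) (hx0 : ∀ i, x i ≠ 0)
    (hk : 1 ≤ k) (hkd : k ≤ d) :
    schlafliMean (faceContent k) H =
      (2 : ℝ) ^ (d - k) * (n.choose (d - k) : ℝ) / (schlafliNumber n d : ℝ) := by
  have hset : {ε : Fin n → Bool | SupportedOn (RandomCones.signed ε x) ∅} =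
      ((Finset.univ.filter fun ε => SupportedOn (RandomCones.signed ε x) ∅ :
        Finset (Fin n → Bool)) : Set (Fin n → Bool)) := by
    ext; simp
  rw [schlafliMean, schlafliCones_eq hx hx0, finsum_mem_image (halfspaceCone_signed_injOn x),
    (halfspaceCone_signed_injOn x).ncard_image, hset, finsum_mem_coe_finset,
    Set.ncard_coe_finset]
  congr 1
  · rw [Finset.sum_filter]
    have hterm : ∀ ε : Fin n → Bool, (if SupportedOn (RandomCones.signed ε x) ∅ then
        faceContent k (halfspaceCone (RandomCones.signed ε x)) else 0) =
        ∑ I ∈ Finset.powersetCard (d - k) Finset.univ,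
          if SupportedOn (RandomCones.signed ε x) I then
            angle (orthFace (RandomCones.signed ε x) I) else 0 := by
      intro ε
      split_ifs with hs
      · exact (h.signed ε).faceContent_halfspaceCone hk hkd
      -- A sign vector that gives no full-dimensional cone contributes nothing: support of `I` would
      -- pass to the empty set.
      · refine (Finset.sum_eq_zero fun I hI => if_neg fun hI' => hs ?_).symm
        exact (h.signed ε).supportedOn_mono (Finset.empty_subset _)
          (by rw [(Finset.mem_powersetCard.1 hI).2]; omega) hI'
    rw [Finset.sum_congr rfl fun ε _ => hterm ε, Finset.sum_comm]
    rw [Finset.sum_congr rfl (g := fun _ => (2 : ℝ) ^ (d - k)) fun I hI => by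
      have hc := (Finset.mem_powersetCard.1 hI).2
      rw [h.sum_angle_orthFace (by omega), hc]]
    rw [Finset.sum_const, Finset.card_powersetCard, Finset.card_univ, Fintype.card_fin,
      nsmul_eq_mul, mul_comm]
  · have := h.sum_supportedOn_empty
    rw [Fintype.card_fin] at this
    rw [← this, Finset.sum_boole]
    congr!

/-! ### Faces of positive hulls -/

/-- No closedness of `Q` is needed. If `Q` spans, its interior is nonempty and is separated from a
point outside `Q`; otherwise any nonzero vector orthogonal to the span works. -/
lemma exists_inner_nonneg_of_ne_top {d : ℕ} {Q : PointedCone ℝ (E d)} (hQ : Q ≠ ⊤) :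
    ∃ y, y ≠ 0 ∧ ∀ z ∈ Q, 0 ≤ ⟪z, y⟫ := by
  by_cases hspan : Submodule.span ℝ (Q : Set (E d)) = ⊤
  · have hne : (interior (Q : Set (E d))).Nonempty := by
      rw [Q.convex.interior_nonempty_iff_affineSpan_eq_top,
        ← Set.insert_eq_of_mem (show (0 : E d) ∈ (Q : Set (E d)) from Q.zero_mem)]
      ext z
      have hz : z ∈ Submodule.span ℝ (Q : Set (E d)) := hspan ▸ Submodule.mem_top
      rw [← SetLike.mem_coe, affineSpan_insert_zero]
      simpa using hz
    obtain ⟨z, hz⟩ : ∃ z, z ∉ Q := by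
      by_contra! h
      exact hQ (eq_top_iff.2 fun z _ => h z)
    obtain ⟨f, hf⟩ := geometric_hahn_banach_open_point Q.convex.interior isOpen_interior
      (fun h => hz (interior_subset h))
    have hle : ∀ a ∈ Q, f a ≤ f z := by
      intro a ha
      have hcl : a ∈ closure (interior (Q : Set (E d))) := by
        rw [Q.convex.closure_interior_eq_closure_of_nonempty_interior hne]
        exact subset_closure ha
      exact closure_minimal (fun b hb => (hf b hb).le)
        (isClosed_le f.continuous continuous_const) hcl
    have hnonpos : ∀ a ∈ Q, f a ≤ 0 := by
      intro a ha
      by_contra! hpos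
      have h0 : 0 ≤ f z := by simpa using hle 0 Q.zero_mem
      -- The multiple of `a` is scaled so that `f` takes the value `f z + 1`, contradicting the
      -- bound `f z`.
      have := hle _ (PointedCone.smul_mem Q (div_nonneg (add_nonneg h0 zero_le_one) hpos.le) ha)
      rw [map_smul, smul_eq_mul, div_mul_cancel₀ _ hpos.ne'] at this
      linarith
    refine ⟨-(InnerProductSpace.toDual ℝ (E d)).symm f, fun h => ?_, fun a ha => ?_⟩
    · obtain ⟨b, hb⟩ := hne
      have h0 : f = 0 := by simpa using h
      have := hf b hb
      simp [h0] at this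
    · rw [inner_neg_right, real_inner_comm, InnerProductSpace.toDual_symm_apply]
      exact neg_nonneg.2 (hnonpos a ha)
  · obtain ⟨y, hy, hy0⟩ := Submodule.exists_mem_ne_zero_of_ne_bot
      (fun h => hspan (Submodule.orthogonal_eq_bot_iff.1 h))
    exact ⟨y, hy0, fun z hz => (((Submodule.mem_orthogonal _ _).1 hy) z
      (Submodule.subset_span hz)).ge⟩

lemma inner_nonneg_of_mem_faceCone {ι : Type} {d : ℕ} {u : ι → E d} {I : Finset ι} {y z : E d}
    (hy : ∀ i ∈ I, 0 ≤ ⟪u i, y⟫) (hz : z ∈ faceCone u I) : 0 ≤ ⟪z, y⟫ := by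
  obtain ⟨a, ha, rfl⟩ := mem_faceCone.1 hz
  rw [sum_inner]
  refine Finset.sum_nonneg fun i _ => ?_
  rw [real_inner_smul_left]
  exact mul_nonneg (ha i) (hy i i.2)

lemma mem_faceCone_of_mem {ι : Type} {d : ℕ} {u : ι → E d} {I : Finset ι} {i : ι} (hi : i ∈ I) :
    u i ∈ faceCone u I :=
  PointedCone.subset_hull ⟨i, hi, rfl⟩

lemma faceCone_mono {ι : Type} {d : ℕ} (u : ι → E d) {I J : Finset ι} (h : I ⊆ J) :
    faceCone u I ≤ faceCone u J :=
  Submodule.span_mono (Set.image_mono h)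

open Classical in
lemma eq_faceCone_of_isFaceOf {ι : Type} [Fintype ι] {d : ℕ} {u : ι → E d}
    {F : PointedCone ℝ (E d)} (hF : F.IsFaceOf (faceCone u Finset.univ)) :
    F = faceCone u (Finset.univ.filter fun i => u i ∈ F) := by
  refine le_antisymm (fun z hz => ?_) (Submodule.span_le.2 ?_)
  · obtain ⟨a, ha, rfl⟩ := mem_faceCone.1 (hF.le hz)
    refine Submodule.sum_mem _ fun i _ => ?_
    rcases (ha i).eq_or_lt with h0 | hpos
    · rw [← h0, zero_smul]
      exact Submodule.zero_mem _
    · refine PointedCone.smul_mem _ hpos.le (mem_faceCone_of_mem ?_)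
      exact Finset.mem_filter.2 ⟨Finset.mem_univ _, hF.mem_of_sum_smul_mem
        (fun j => mem_faceCone_of_mem j.2) ha hz i hpos⟩
  · rintro _ ⟨i, hi, rfl⟩
    exact (Finset.mem_filter.1 hi).2

/-- A summand of a point of `faceCone u I` must have zero inner product with the supporting `y`, so
its coefficients off `I` vanish. -/
lemma isFaceOf_faceCone {ι : Type} [Fintype ι] {d : ℕ} {u : ι → E d} {I : Finset ι}
    (h : SupportedOn u I) : (faceCone u I).IsFaceOf (faceCone u Finset.univ) := by
  classical
  obtain ⟨y, h0, h1⟩ := h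
  have hnn : ∀ i ∈ (Finset.univ : Finset ι), 0 ≤ ⟪u i, y⟫ := fun i _ => by
    by_cases hi : i ∈ I
    · exact (h0 i hi).ge
    · exact (h1 i hi).le
  refine ⟨faceCone_mono u (Finset.subset_univ I), fun {a b t} ha hb ht hab => ?_⟩
  have hzero : ⟪t • a + b, y⟫ = 0 := by
    refine le_antisymm ?_ ?_
    · have := inner_nonneg_of_mem_faceCone (y := -y)
        (fun i hi => by rw [inner_neg_right, h0 i hi, neg_zero]) hab
      rw [inner_neg_right] at this
      linarith
    · exact inner_nonneg_of_mem_faceCone (fun i hi => (h0 i hi).ge) hab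
  rw [inner_add_left, real_inner_smul_left] at hzero
  have ha0 : ⟪a, y⟫ = 0 := by
    have h2 := inner_nonneg_of_mem_faceCone hnn ha
    have h3 := inner_nonneg_of_mem_faceCone hnn hb
    nlinarith
  obtain ⟨c, hc, rfl⟩ := mem_faceCone.1 ha
  rw [sum_inner, Finset.sum_eq_zero_iff_of_nonneg (fun i _ => by
    rw [real_inner_smul_left]; exact mul_nonneg (hc i) (hnn i i.2))] at ha0
  refine Submodule.sum_mem _ fun i _ => ?_
  by_cases hi : (i : ι) ∈ I
  · exact PointedCone.smul_mem _ (hc i) (mem_faceCone_of_mem hi)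
  · have := ha0 i (Finset.mem_univ i)
    rw [real_inner_smul_left] at this
    rw [(mul_eq_zero.1 this).resolve_right (h1 i hi).ne', zero_smul]
    exact Submodule.zero_mem _

lemma faceCone_injOn {ι : Type} {d : ℕ} (u : ι → E d) :
    Set.InjOn (faceCone u) {I | SupportedOn u I} := by
  have key : ∀ I J, SupportedOn u I → faceCone u I = faceCone u J → J ⊆ I := by
    rintro I J ⟨y, h0, h1⟩ h i hi
    by_contra hiI
    have hmem := mem_faceCone_of_mem (u := u) hi
    rw [← h] at hmem
    have := inner_nonneg_of_mem_faceCone (y := -y)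
      (fun i hi => by rw [inner_neg_right, h0 i hi, neg_zero]) hmem
    rw [inner_neg_right] at this
    linarith [h1 i hiI]
  exact fun I hI J hJ h => (key J I hJ h.symm).antisymm (key I J hI h)

lemma GenPos.card_eq_of_finrank_span {ι : Type} {d k : ℕ} {u : ι → E d} (h : GenPos d u)
    {I : Finset ι} (hk : k < d) (hI : Module.finrank ℝ (Submodule.span ℝ (u '' I)) = k) :
    I.card = k := by
  by_cases hc : I.card ≤ d
  · rwa [h.finrank_span hc] at hI
  · exfalso
    have : orth u I = ⊥ := by
      rw [eq_bot_iff]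
      intro y hy
      exact (Submodule.mem_bot ℝ).2 (h.eq_zero_of_inner_eq_zero (not_le.1 hc).le (mem_orth.1 hy))
    rw [orth, Submodule.orthogonal_eq_bot_iff] at this
    rw [this, finrank_top, finrank_euclideanSpace_fin] at hI
    omega

/-- A vector nonnegative on the sum of the cone and the span `W` of the face vanishes on `W`, and
general position makes it strict off `I`. It exists once this sum is not the whole space. -/
lemma GenPos.supportedOn_of_isFaceOf {ι : Type} [Fintype ι] {d : ℕ} {u : ι → E d} (h : GenPos d u)
    {I : Finset ι} (hI : I.card < d) (hF : (faceCone u I).IsFaceOf (faceCone u Finset.univ))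
    (hmem : ∀ i, u i ∈ faceCone u I → i ∈ I) : SupportedOn u I := by
  classical
  set W := Submodule.span ℝ (u '' (I : Set ι)) with hW
  have hQ : faceCone u Finset.univ ⊔ (W : PointedCone ℝ (E d)) ≠ ⊤ := by
    intro htop
    by_cases hex : ∃ j, j ∉ I
    · obtain ⟨j, hj⟩ := hex
      have hj' : -u j ∈ faceCone u Finset.univ ⊔ (W : PointedCone ℝ (E d)) :=
        htop ▸ Submodule.mem_top
      obtain ⟨p, hp, w, hw, hpw⟩ := Submodule.mem_sup.1 hj'
      have hw' : w ∈ Submodule.span ℝ (faceCone u I : Set (E d)) := by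
        rw [span_faceCone]; exact hw
      obtain ⟨a, ha, b, hb, rfl⟩ := exists_sub_of_mem_span _ hw'
      -- Here `-u j = p + (a - b)` with `a, b` in the face, so `u j` is a summand of a point of the
      -- face, which forces `j ∈ I`.
      have hb' : u j + (p + a) = b := by
        have : p + a - b = -u j := by rw [← hpw]; abel
        rw [sub_eq_iff_eq_add] at this
        rw [this]
        abel
      exact hj (hmem j (hF.mem_of_add_mem_left (mem_faceCone_of_mem (Finset.mem_univ j))
        (Submodule.add_mem _ hp (hF.le ha)) (hb' ▸ hb)))
    · push Not at hex
      have hle : faceCone u Finset.univ ⊔ (W : PointedCone ℝ (E d)) ≤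
          (W : PointedCone ℝ (E d)) := by
        refine sup_le (Submodule.span_le.2 ?_) le_rfl
        rintro _ ⟨i, -, rfl⟩
        exact Submodule.subset_span ⟨i, hex i, rfl⟩
      rw [htop] at hle
      have hWt : W = ⊤ := eq_top_iff.2 fun z _ => hle (Submodule.mem_top (x := z))
      have := h.finrank_span hI.le
      rw [← hW, hWt, finrank_top, finrank_euclideanSpace_fin] at this
      omega
  obtain ⟨y, hy0, hy⟩ := exists_inner_nonneg_of_ne_top hQ
  refine h.supportedOn_of_nonneg_of_ne_zero hy0 (fun i hi => le_antisymm ?_ ?_) fun i => ?_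
  · have := hy (-u i) ((le_sup_right : (W : PointedCone ℝ (E d)) ≤ _)
      (W.neg_mem (Submodule.subset_span ⟨i, hi, rfl⟩)))
    rw [inner_neg_left] at this
    linarith
  all_goals exact hy _ ((le_sup_left : _ ≤ faceCone u Finset.univ ⊔ (W : PointedCone ℝ (E d)))
      (mem_faceCone_of_mem (Finset.mem_univ i)))

lemma GenPos.faceCone_univ_ne_top_iff {ι : Type} [Fintype ι] [Nonempty ι] {d : ℕ} {u : ι → E d}
    (h : GenPos d u) : faceCone u Finset.univ ≠ ⊤ ↔ SupportedOn u ∅ := by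
  constructor
  · intro hne
    obtain ⟨y, hy0, hy⟩ := exists_inner_nonneg_of_ne_top hne
    exact h.supportedOn_of_nonneg_of_ne_zero hy0 (by simp)
      fun i => hy _ (mem_faceCone_of_mem (Finset.mem_univ i))
  · rintro ⟨y, -, hy⟩ htop
    have hmem : -y ∈ faceCone u Finset.univ := htop ▸ Submodule.mem_top
    have := inner_nonneg_of_mem_faceCone (fun i _ => (hy i (by simp)).le) hmem
    rw [inner_neg_left] at this
    have hy0 : y = 0 := inner_self_eq_zero.1
      (le_antisymm (neg_nonneg.1 this) real_inner_self_nonneg)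
    have hpos := hy (Classical.arbitrary ι) (by simp)
    simp [hy0] at hpos

open Classical in
lemma GenPos.faceContent_faceCone {ι : Type} [Fintype ι] {d k : ℕ} {u : ι → E d}
    (h : GenPos d u) (hk : k < d) :
    faceContent k (faceCone u Finset.univ) = ∑ I ∈ Finset.powersetCard k Finset.univ,
      if SupportedOn u I then angle (faceCone u I) else 0 := by
  rw [faceContent_eq, ← Finset.sum_filter]
  have hset : kFaces k (faceCone u Finset.univ) = faceCone u '' ((Finset.powersetCard k
      Finset.univ).filter fun I => SupportedOn u I : Finset (Finset ι)) := by
    ext F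
    simp only [Set.mem_image, SetLike.mem_coe, Finset.mem_filter, Finset.mem_powersetCard,
      Finset.subset_univ, true_and]
    constructor
    · rintro ⟨hF, hdim⟩
      have hFI := eq_faceCone_of_isFaceOf hF
      have hc : (Finset.univ.filter fun i => u i ∈ F).card = k := by
        rw [hFI, coneDim, span_faceCone] at hdim
        exact h.card_eq_of_finrank_span hk hdim
      refine ⟨_, ⟨hc, h.supportedOn_of_isFaceOf (by omega) (hFI ▸ hF) fun i hi => ?_⟩, hFI.symm⟩
      rw [← hFI] at hi
      simpa using hi
    · rintro ⟨I, ⟨hc, hI⟩, rfl⟩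
      refine ⟨isFaceOf_faceCone hI, ?_⟩
      rw [coneDim, span_faceCone, h.finrank_span (by omega), hc]
  rw [hset, finsum_mem_image, finsum_mem_coe_finset]
  exact (faceCone_injOn u).mono fun I hI => (Finset.mem_filter.1 hI).2

/-- For each `I` the angle depends only on the signs on `I` and the support condition only on those
off `I`, so the sum over `ε` is a product: total angle 1 times a number of cells. -/
theorem GenPos.sum_faceContent_faceCone {ι : Type} [Fintype ι] [DecidableEq ι] {d k : ℕ}
    {x : ι → E d} (h : GenPos d x) (hk1 : 1 ≤ k) (hk : k < d) :
    ∑ ε : ι → Bool, faceContent k (faceCone (RandomCones.signed ε x) Finset.univ) =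
      ((Fintype.card ι).choose k : ℝ) *
        (schlafliNumber ((Fintype.card ι : ℤ) - k) (d - k) : ℝ) := by
  classical
  simp_rw [fun ε => (h.signed ε).faceContent_faceCone hk]
  rw [Finset.sum_comm, Finset.sum_congr rfl (g := fun _ =>
    (schlafliNumber ((Fintype.card ι : ℤ) - k) (d - k) : ℝ))]
  · rw [Finset.sum_const, Finset.card_powersetCard, Finset.card_univ, nsmul_eq_mul]
  · intro I hI
    have hc := (Finset.mem_powersetCard.1 hI).2
    have hli := h I (by omega)
    have hne : I.Nonempty := Finset.card_pos.1 (by omega)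
    have h1 := sum_mul_sum_sign I (orthantRatio x I) fun ε =>
      if Feasible (RandomCones.orthFunctional x I) ε then (1 : ℝ) else 0
    rw [sum_orthantRatio hli, one_mul, h.sum_feasible_orthFunctional (by omega), hc] at h1
    rw [← h1]
    refine Finset.sum_congr rfl fun ε _ => ?_
    rw [if_congr (supportedOn_signed_iff x I ε) rfl rfl, angle_faceCone_signed hli hne, mul_ite,
      mul_one, mul_zero]

/-! ### Random vectors are in general position -/

lemma exists_ne_zero_inner_eq_zero {d : ℕ} {W : Submodule ℝ (E d)} (hW : W ≠ ⊤) :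
    ∃ v : E d, v ≠ 0 ∧ ∀ w ∈ W, ⟪w, v⟫ = 0 := by
  obtain ⟨v, hv, hv0⟩ := Submodule.exists_mem_ne_zero_of_ne_bot
    (fun h => hW (Submodule.orthogonal_eq_bot_iff.1 h))
  exact ⟨v, hv0, (Submodule.mem_orthogonal _ _).1 hv⟩

/-- The kernel of `A = ∑ w i ⊗ w i` is the orthogonal complement of the span, so its rank is the
dimension of the span. A lower bound on rank is an open condition on `A`. -/
lemma linearIndepOn_iff_le_rank {ι : Type} {d : ℕ} (w : ι → E d) (S : Finset ι)
    (A : E d →ₗ[ℝ] E d) (hA : ∀ v, A v = ∑ i ∈ S, ⟪w i, v⟫ • w i) :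
    LinearIndepOn ℝ w (S : Set ι) ↔ (S.card : Cardinal) ≤ A.rank := by
  have hker : LinearMap.ker A = orth w S := by
    ext v
    rw [LinearMap.mem_ker, mem_orth, hA]
    refine ⟨fun h => ?_, fun h => Finset.sum_eq_zero fun i hi => by rw [h i hi, zero_smul]⟩
    have h1 : ∑ i ∈ S, ⟪w i, v⟫ * ⟪w i, v⟫ = 0 := by
      have := congrArg (fun z => ⟪z, v⟫) h
      simpa [sum_inner, real_inner_smul_left] using this
    rw [Finset.sum_eq_zero_iff_of_nonneg fun i _ => mul_self_nonneg _] at h1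
    exact fun i hi => mul_self_eq_zero.1 (h1 i hi)
  have hrange : Module.finrank ℝ (LinearMap.range A) =
      Module.finrank ℝ (Submodule.span ℝ (w '' S)) := by
    have h1 := LinearMap.finrank_range_add_finrank_ker A
    have h2 := Submodule.finrank_add_finrank_orthogonal (Submodule.span ℝ (w '' (S : Set ι)))
    rw [hker, orth] at h1
    omega
  have hli : LinearIndepOn ℝ w (S : Set ι) ↔
      S.card ≤ Module.finrank ℝ (Submodule.span ℝ (w '' S)) := by
    have := linearIndependent_iff_card_le_finrank_span (R := ℝ) (b := fun i : (S : Set ι) => w i)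
    rw [Set.image_eq_range]
    rw [LinearIndepOn]
    simpa [Set.finrank] using this
  rw [hli, LinearMap.rank, ← Module.finrank_eq_rank, hrange, Nat.cast_le]

section GeneralPosition

variable {X : Type} [TopologicalSpace X] [SecondCountableTopology X] [MeasurableSpace X]
  [BorelSpace X] {d n : ℕ} {u : X → E d} {Q : X → E d →L[ℝ] E d}

/-- Only the rank-one operator `Q x = u x ⊗ u x` is assumed continuous, not `u`: the unit normal of
a hyperplane is an arbitrary choice of sign, but its square is not. -/
lemma measurableSet_linearIndepOn (hQ : Continuous Q) (hu : ∀ x v, Q x v = ⟪u x, v⟫ • u x)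
    (S : Finset (Fin n)) :
    MeasurableSet {x : Fin n → X | LinearIndepOn ℝ (fun i => u (x i)) (S : Set (Fin n))} := by
  have hc : Continuous fun x : Fin n → X => ∑ i ∈ S, Q (x i) :=
    continuous_finsetSum _ fun i _ => hQ.comp (continuous_apply i)
  have ho := (isOpen_setOfPred_nat_le_rank (𝕜 := ℝ) (E := E d) (F := E d)
    S.card).preimage hc
  convert ho.measurableSet using 1
  ext x
  refine linearIndepOn_iff_le_rank (fun i => u (x i)) S
    ((∑ i ∈ S, Q (x i) : E d →L[ℝ] E d) : E d →ₗ[ℝ] E d) fun v => ?_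
  rw [ContinuousLinearMap.coe_coe, sum_apply]
  exact Finset.sum_congr rfl fun i _ => hu _ _

variable (φ : Measure X) [IsProbabilityMeasure φ]

/-- Induction on `S` with Fubini: fix all coordinates except `a`. The span of the earlier vectors
has dimension below `d`, hence a nonzero normal `v`, and the new vector falls into the span only on
the null event `⟪u t, v⟫ = 0`. -/
lemma ae_linearIndepOn (hQ : Continuous Q) (hu : ∀ x v, Q x v = ⟪u x, v⟫ • u x)
    (hφ : ∀ v : E d, v ≠ 0 → φ {x | ⟪u x, v⟫ = 0} = 0) (S : Finset (Fin n)) (hS : S.card ≤ d) :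
    ∀ᵐ x ∂(Measure.pi fun _ : Fin n => φ),
      LinearIndepOn ℝ (fun i => u (x i)) (S : Set (Fin n)) := by
  classical
  induction S using Finset.induction_on with
  | empty => simp
  | insert a S ha ih =>
    rw [Finset.card_insert_of_notMem ha] at hS
    set B : Set (Fin n → X) := {x | LinearIndepOn ℝ (fun i => u (x i)) (S : Set (Fin n))} \
      {x | LinearIndepOn ℝ (fun i => u (x i)) ((insert a S : Finset (Fin n)) : Set (Fin n))} with hB
    have hBm : MeasurableSet B :=
      (measurableSet_linearIndepOn hQ hu S).diff (measurableSet_linearIndepOn hQ hu _)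
    have hnull : (Measure.pi fun _ : Fin n => φ) B = 0 := by
      rcases isEmpty_or_nonempty X with hX | hX
      · have : (Measure.pi fun _ : Fin n => φ) Set.univ = 0 := by
          have : IsEmpty (Fin n → X) := ⟨fun x => hX.elim (x a)⟩
          rw [Set.univ_eq_empty_iff.2 this, measure_empty]
        exact measure_mono_null (Set.subset_univ _) this
      obtain ⟨x₀⟩ : Nonempty (Fin n → X) := inferInstance
      have hf : Measurable (B.indicator (1 : (Fin n → X) → ENNReal)) :=
        measurable_one.indicator hBm
      rw [← lintegral_indicator_one hBm, lintegral_eq_lmarginal_univ x₀,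
        lmarginal_erase' _ hf (Finset.mem_univ a)]
      have hzero : (fun x : Fin n → X => ∫⁻ t, B.indicator (1 : (Fin n → X) → ENNReal)
          (Function.update x a t) ∂φ) = fun _ => 0 := by
        funext x
        have hW : Submodule.span ℝ ((fun i => u (x i)) '' (S : Set (Fin n))) ≠ ⊤ := by
          intro h
          have h1 := finrank_span_finset_le_card (R := ℝ) (S.image fun i => u (x i))
          rw [Finset.coe_image, Set.finrank, h, finrank_top, finrank_euclideanSpace_fin] at h1
          have h2 : (S.image fun i => u (x i)).card ≤ S.card := Finset.card_image_le
          omega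
        obtain ⟨v, hv0, hv⟩ := exists_ne_zero_inner_eq_zero hW
        have hsub : ∀ᵐ t ∂φ,
            B.indicator (1 : (Fin n → X) → ENNReal) (Function.update x a t) = 0 := by
          have : ∀ᵐ t ∂φ, ¬ ⟪u t, v⟫ = 0 := by
            rw [ae_iff]
            simpa using hφ v hv0
          filter_upwards [this] with t ht
          refine Set.indicator_of_notMem (fun hmem => ht ?_) _
          obtain ⟨h1, h2⟩ := hmem
          rw [Set.mem_ofPred_eq] at h1 h2
          rw [Finset.coe_insert, linearIndepOn_insert (by simpa using ha), not_and, not_not] at h2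
          have h3 := h2 h1
          rw [Function.update_self] at h3
          have himg : (fun i => u (Function.update x a t i)) '' (S : Set (Fin n)) =
              (fun i => u (x i)) '' (S : Set (Fin n)) := by
            refine Set.image_congr fun i hi => ?_
            have hia : i ≠ a := fun h => ha (h ▸ hi)
            rw [Function.update_of_ne hia]
          rw [himg] at h3
          exact hv _ h3
        rw [lintegral_congr_ae hsub, lintegral_zero]
      rw [hzero]
      simp [lmarginal]
    have hae : ∀ᵐ x ∂(Measure.pi fun _ : Fin n => φ), x ∉ B := measure_eq_zero_iff_ae_notMem.1 hnull
    filter_upwards [ih (by omega), hae] with x hx hxB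
    by_contra hcon
    exact hxB ⟨hx, hcon⟩

theorem ae_genPos (hQ : Continuous Q) (hu : ∀ x v, Q x v = ⟪u x, v⟫ • u x)
    (hφ : ∀ v : E d, v ≠ 0 → φ {x | ⟪u x, v⟫ = 0} = 0) :
    ∀ᵐ x ∂(Measure.pi fun _ : Fin n => φ), GenPos d fun i => u (x i) := by
  refine ae_all_iff.2 fun S => ?_
  by_cases hS : S.card ≤ d
  · filter_upwards [ae_linearIndepOn φ hQ hu hφ S hS] with x hx _
    exact hx
  · exact Filter.Eventually.of_forall fun x h => absurd h hS

end GeneralPosition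

/-! ### Hyperplanes -/

instance (d k : ℕ) : SecondCountableTopology (Grassmannian d k) :=
  TopologicalSpace.secondCountableTopology_induced _ _ _

lemma Grassmannian.exists_unit_normal {d : ℕ} (hd : 1 ≤ d) (H : Grassmannian d (d - 1)) :
    ∃ u : E d, ‖u‖ = 1 ∧ H.1ᗮ = ℝ ∙ u := by
  have h1 := Submodule.finrank_add_finrank_orthogonal H.1
  rw [H.2, finrank_euclideanSpace_fin] at h1
  have h2 : Module.finrank ℝ H.1ᗮ = 1 := by omega
  obtain ⟨v, hv, hv0⟩ := Submodule.exists_mem_ne_zero_of_ne_bot (p := H.1ᗮ) (by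
    intro h
    rw [h, finrank_bot] at h2
    omega)
  have hn : ‖v‖ ≠ 0 := norm_ne_zero_iff.2 hv0
  have hu : ‖‖v‖⁻¹ • v‖ = 1 := by rw [norm_smul, norm_inv, norm_norm, inv_mul_cancel₀ hn]
  refine ⟨‖v‖⁻¹ • v, hu, (Submodule.eq_of_le_of_finrank_eq ?_ ?_).symm⟩
  · rw [Submodule.span_singleton_le_iff_mem]
    exact Submodule.smul_mem _ _ hv
  · rw [h2, finrank_span_singleton]
    exact norm_ne_zero_iff.1 (by rw [hu]; exact one_ne_zero)

/-- A unit normal vector of a hyperplane. -/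
def Grassmannian.normal {d : ℕ} (H : Grassmannian d (d - 1)) : E d :=
  if hd : 1 ≤ d then (H.exists_unit_normal hd).choose else 0

lemma Grassmannian.norm_normal {d : ℕ} (hd : 1 ≤ d) (H : Grassmannian d (d - 1)) :
    ‖H.normal‖ = 1 := by
  rw [Grassmannian.normal, dif_pos hd]
  exact (H.exists_unit_normal hd).choose_spec.1

lemma Grassmannian.orthogonal_eq {d : ℕ} (hd : 1 ≤ d) (H : Grassmannian d (d - 1)) :
    H.1ᗮ = ℝ ∙ H.normal := by
  rw [Grassmannian.normal, dif_pos hd]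
  exact (H.exists_unit_normal hd).choose_spec.2

/-- The mean is almost surely constant, which settles integrability and the value at once. The
continuous operator is the projection onto the normal line. -/
theorem hasSchlafliExpectation_faceContent {d n k : ℕ} (hd : 1 ≤ d)
    (φ : Measure (Grassmannian d (d - 1))) [IsProbabilityMeasure φ]
    (hφ : ∀ v : E d, v ≠ 0 → φ {H | v ∈ H.1} = 0) (hk : 1 ≤ k) (hkd : k ≤ d) :
    HasSchlafliExpectation φ n (faceContent k)
      ((2 : ℝ) ^ (d - k) * (n.choose (d - k) : ℝ) / (schlafliNumber n d : ℝ)) := by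
  have hQ : Continuous fun H : Grassmannian d (d - 1) =>
      ContinuousLinearMap.id ℝ (E d) - (H.1.starProjection : E d →L[ℝ] E d) :=
    continuous_const.sub continuous_induced_dom
  have hu : ∀ (H : Grassmannian d (d - 1)) (v : E d),
      (ContinuousLinearMap.id ℝ (E d) - (H.1.starProjection : E d →L[ℝ] E d)) v =
        ⟪H.normal, v⟫ • H.normal := by
    intro H v
    rw [← Submodule.starProjection_unit_singleton ℝ (H.norm_normal hd)]
    simp only [← H.orthogonal_eq hd]
    rw [Submodule.starProjection_orthogonal]
  have hnull : ∀ v : E d, v ≠ 0 → φ {H | ⟪H.normal, v⟫ = 0} = 0 := by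
    intro v hv
    rw [← hφ v hv]
    congr 1
    ext H
    change ⟪H.normal, v⟫ = 0 ↔ v ∈ H.1
    rw [← Submodule.mem_orthogonal_singleton_iff_inner_right,
      ← H.orthogonal_eq hd, Submodule.orthogonal_orthogonal]
  have hae : ∀ᵐ H ∂(Measure.pi fun _ : Fin n => φ), schlafliMean (faceContent k) H =
      (2 : ℝ) ^ (d - k) * (n.choose (d - k) : ℝ) / (schlafliNumber n d : ℝ) := by
    filter_upwards [ae_genPos φ hQ hu hnull] with H hH
    exact hH.schlafliMean_faceContent (fun i => (H i).orthogonal_eq hd)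
      (fun i => norm_ne_zero_iff.1 (by rw [(H i).norm_normal hd]; exact one_ne_zero)) hk hkd
  refine ⟨(integrable_congr hae).2 (integrable_const _), ?_⟩
  rw [integral_congr_ae hae]
  simp

/-! ### Random points on the sphere -/

/-- The points of the sphere as vectors. -/
def coords {d n : ℕ} (x : Fin n → Sph d) : Fin n → E d := fun i => x i

lemma continuous_coords_apply {d n : ℕ} (i : Fin n) :
    Continuous fun x : Fin n → Sph d => coords x i :=
  continuous_subtype_val.comp (continuous_apply i)

lemma posHull_eq {d n : ℕ} (x : Fin n → Sph d) :
    posHull x = faceCone (coords x) Finset.univ := by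
  rw [posHull, faceCone, Finset.coe_univ, Set.image_univ]
  rfl

/-- The points `x i` with signs given by `ε`. -/
def flip {d n : ℕ} (ε : Fin n → Bool) (x : Fin n → Sph d) : Fin n → Sph d :=
  fun i => if ε i then x i else -x i

lemma coords_flip {d n : ℕ} (ε : Fin n → Bool) (x : Fin n → Sph d) :
    coords (flip ε x) = signed ε (coords x) := by
  funext i
  unfold coords flip signed
  cases ε i <;> simp

lemma measurePreserving_flip {d n : ℕ} {φ : Measure (Sph d)} [IsProbabilityMeasure φ]
    (hφ : φ.map (fun x => -x) = φ) (ε : Fin n → Bool) :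
    MeasurePreserving (flip ε) (Measure.pi fun _ : Fin n => φ) (Measure.pi fun _ : Fin n => φ) := by
  refine measurePreserving_pi (fun _ => φ) (fun _ => φ)
    (f := fun i (y : Sph d) => if ε i then y else -y) fun i => ?_
  cases ε i
  · exact ⟨continuous_neg.measurable, hφ⟩
  · exact MeasurePreserving.id φ

/-- Each `flip ε` preserves the product measure, so all `2 ^ n` terms of the sum have the same
integral. -/
lemma integral_eq_of_sum_flip {d n : ℕ} {φ : Measure (Sph d)} [IsProbabilityMeasure φ]
    (hφ : φ.map (fun x => -x) = φ) {G : (Fin n → Sph d) → ℝ}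
    (hG : Integrable G (Measure.pi fun _ : Fin n => φ)) {c : ℝ}
    (hc : ∀ᵐ x ∂(Measure.pi fun _ : Fin n => φ), ∑ ε : Fin n → Bool, G (flip ε x) = c) :
    ∫ x, G x ∂(Measure.pi fun _ : Fin n => φ) = c / 2 ^ n := by
  have hε : ∀ ε : Fin n → Bool, ∫ x, G (flip ε x) ∂(Measure.pi fun _ : Fin n => φ) =
      ∫ x, G x ∂(Measure.pi fun _ : Fin n => φ) := by
    intro ε
    have hmp := measurePreserving_flip (n := n) hφ ε
    have := integral_map (f := G) hmp.aemeasurable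
      (by rw [hmp.map_eq]; exact hG.aestronglyMeasurable)
    rw [hmp.map_eq] at this
    exact this.symm
  have h1 := integral_congr_ae hc
  rw [integral_finsetSum (f := fun ε x => G (flip ε x)) _ fun ε _ =>
      (measurePreserving_flip hφ ε).integrable_comp_of_integrable hG,
    Finset.sum_congr rfl fun ε _ => hε ε] at h1
  simp only [Finset.sum_const, Finset.card_univ, Fintype.card_pi, Fintype.card_bool,
    Finset.prod_const, Fintype.card_fin, nsmul_eq_mul, integral_const, probReal_univ,
    one_smul] at h1
  rw [eq_div_iff (by positivity), ← h1]
  push_cast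
  ring

lemma ae_genPos_coords {d n : ℕ} {φ : Measure (Sph d)} [IsProbabilityMeasure φ]
    (hφ : ∀ L : Grassmannian d (d - 1), φ {x | (x : E d) ∈ L.1} = 0) :
    ∀ᵐ x ∂(Measure.pi fun _ : Fin n => φ), GenPos d (coords x) := by
  refine ae_genPos (Q := fun x : Sph d => (innerSL ℝ (x : E d)).smulRight (x : E d)) φ ?_
    (fun x v => by simp) fun v hv => ?_
  · have h1 : Continuous fun x : Sph d => ContinuousLinearMap.smulRightL ℝ (E d) (E d)
        (innerSL ℝ (x : E d)) (x : E d) :=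
      ((ContinuousLinearMap.smulRightL ℝ (E d) (E d)).continuous.comp
        ((innerSL ℝ).continuous.comp continuous_subtype_val)).clm_apply continuous_subtype_val
    exact h1
  · have hfin : Module.finrank ℝ (ℝ ∙ v)ᗮ = d - 1 := by
      have := Submodule.finrank_add_finrank_orthogonal (ℝ ∙ v)
      rw [finrank_span_singleton hv, finrank_euclideanSpace_fin] at this
      omega
    rw [← hφ ⟨(ℝ ∙ v)ᗮ, hfin⟩]
    congr 1
    ext x
    change ⟪(x : E d), v⟫ = 0 ↔ (x : E d) ∈ (ℝ ∙ v)ᗮ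
    rw [Submodule.mem_orthogonal_singleton_iff_inner_left]

/-! ### Measurability -/

/-- The vectors `x i`, `i ∈ I`, lie in a supporting hyperplane of the positive hull of all `x i`. -/
def weaklySupported {d n : ℕ} (I : Finset (Fin n)) : Set (Fin n → Sph d) :=
  {x | ∃ y : Sph d, (∀ i ∈ I, ⟪coords x i, (y : E d)⟫ = 0) ∧ ∀ i, 0 ≤ ⟪coords x i, (y : E d)⟫}

/-- The weak conditions are closed jointly in `x` and `y`, and projecting along the compact sphere
keeps the set closed. -/
lemma measurableSet_weaklySupported {d n : ℕ} (I : Finset (Fin n)) :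
    MeasurableSet (weaklySupported (d := d) I) := by
  have hclosed : IsClosed {p : (Fin n → Sph d) × Sph d |
      (∀ i ∈ I, ⟪coords p.1 i, (p.2 : E d)⟫ = 0) ∧ ∀ i, 0 ≤ ⟪coords p.1 i, (p.2 : E d)⟫} := by
    have hc : ∀ i, Continuous fun p : (Fin n → Sph d) × Sph d => ⟪coords p.1 i, (p.2 : E d)⟫ :=
      fun i => ((continuous_coords_apply i).comp continuous_fst).inner
        (continuous_subtype_val.comp continuous_snd)
    rw [Set.ofPred_and, Set.ofPred_forall, Set.ofPred_forall]
    refine IsClosed.inter (isClosed_iInter fun i => ?_) (isClosed_iInter fun i => ?_)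
    · rw [Set.ofPred_forall]
      exact isClosed_iInter fun _ => isClosed_eq (hc i) continuous_const
    · exact isClosed_le continuous_const (hc i)
  have := (isClosedMap_fst_of_compactSpace _ hclosed).measurableSet
  convert this using 1
  ext x
  simp [weaklySupported]

lemma GenPos.mem_weaklySupported_iff {d n : ℕ} {x : Fin n → Sph d} (h : GenPos d (coords x))
    {I : Finset (Fin n)} (hI : I.card < d) : x ∈ weaklySupported I ↔ SupportedOn (coords x) I := by
  constructor
  · rintro ⟨y, h0, h1⟩
    exact h.supportedOn_of_nonneg_of_ne_zero (y := y)
      (fun hy => by have := y.2; rw [hy] at this; simp at this) h0 h1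
  · intro hs
    obtain ⟨y, hy0, h0, h1⟩ : ∃ y : E d, y ≠ 0 ∧ (∀ i ∈ I, ⟪coords x i, y⟫ = 0) ∧
        ∀ i, 0 ≤ ⟪coords x i, y⟫ := by
      obtain ⟨y, h0, h1⟩ := hs
      by_cases hex : ∃ j, j ∉ I
      · obtain ⟨j, hj⟩ := hex
        refine ⟨y, fun hy => ?_, h0, fun i => ?_⟩
        · have := h1 j hj
          simp [hy] at this
        · by_cases hi : i ∈ I
          · exact (h0 i hi).ge
          · exact (h1 i hi).le
      -- If `I` contains every index, the supporting vector may be 0; a nonzero one is taken from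
      -- `orth (coords x) I`, of positive dimension as `I.card < d`.
      · push Not at hex
        have hfin := h.finrank_orth hI.le
        obtain ⟨z, hz, hz0⟩ := Submodule.exists_mem_ne_zero_of_ne_bot (p := orth (coords x) I) (by
          intro hb
          rw [hb, finrank_bot] at hfin
          omega)
        exact ⟨z, hz0, mem_orth.1 hz, fun i => (mem_orth.1 hz i (hex i)).ge⟩
    have hpos : 0 < ‖y‖ := norm_pos_iff.2 hy0
    refine ⟨⟨‖y‖⁻¹ • y, ?_⟩, fun i hi => ?_, fun i => ?_⟩
    · rw [mem_sphere_zero_iff_norm, norm_smul, norm_inv, norm_norm, inv_mul_cancel₀ hpos.ne']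
    · rw [real_inner_smul_right, h0 i hi, mul_zero]
    · rw [real_inner_smul_right]
      exact mul_nonneg (inv_nonneg.2 hpos.le) (h1 i)

/-- Both volumes are sections, over a fixed coordinate space, of sets measurable jointly in `x` and
the coordinates. -/
lemma measurable_orthantRatio {d n : ℕ} (I : Finset (Fin n)) (ε : {i // i ∈ I} → Bool) :
    Measurable fun x : Fin n → Sph d => orthantRatio (coords x) I ε := by
  have hB : MeasurableSet {p : (Fin n → Sph d) × ({i // i ∈ I} → ℝ) |
      ‖∑ i, p.2 i • coords p.1 i‖ < 1} := by
    refine (isOpen_lt (Continuous.norm (continuous_finsetSum _ fun i _ => ?_))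
      continuous_const).measurableSet
    exact ((continuous_apply i).comp continuous_snd).smul
      ((continuous_coords_apply (i : Fin n)).comp continuous_fst)
  have hA : MeasurableSet {p : (Fin n → Sph d) × ({i // i ∈ I} → ℝ) |
      ∀ i, 0 ≤ sgn (ε i) * p.2 i} :=
    measurable_snd (measurableSet_signCell (V := {i // i ∈ I} → ℝ) (fun i => LinearMap.proj i) ε)
  exact (measurable_measure_prodMk_left (hA.inter hB)).ennreal_toReal.div
    (measurable_measure_prodMk_left hB).ennreal_toReal

lemma orthantRatio_nonneg {ι : Type} {d : ℕ} (x : ι → E d) (I : Finset ι)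
    (ε : {i // i ∈ I} → Bool) : 0 ≤ orthantRatio x I ε :=
  div_nonneg measureReal_nonneg measureReal_nonneg

lemma orthantRatio_le_one {ι : Type} {d : ℕ} {x : ι → E d} {I : Finset ι}
    (h : LinearIndepOn ℝ x (I : Set ι)) (ε : {i // i ∈ I} → Bool) : orthantRatio x I ε ≤ 1 := by
  classical
  rw [← sum_orthantRatio h]
  exact Finset.single_le_sum (f := fun ε => orthantRatio x I ε)
    (fun ε _ => orthantRatio_nonneg x I ε) (Finset.mem_univ ε)

lemma angle_faceCone {ι : Type} {d : ℕ} {x : ι → E d} {I : Finset ι}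
    (h : LinearIndepOn ℝ x (I : Set ι)) (hI : I.Nonempty) :
    angle (faceCone x I) = orthantRatio x I fun _ => true := by
  rw [← angle_faceCone_signed h hI fun _ => true]
  congr 2
  funext i
  simp [signed]

/-! ### The expectation for the Cover–Efron cone -/

section CoverEfron

variable {d n k : ℕ} {φ : Measure (Sph d)} [IsProbabilityMeasure φ]

lemma GenPos.faceContent_posHull {x : Fin n → Sph d} (h : GenPos d (coords x)) (hk : 1 ≤ k)
    (hkd : k < d) :
    faceContent k (posHull x) = ∑ I ∈ Finset.powersetCard k Finset.univ,
      (weaklySupported I).indicator (fun x => orthantRatio (coords x) I fun _ => true) x := by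
  classical
  rw [posHull_eq, h.faceContent_faceCone hkd]
  refine Finset.sum_congr rfl fun I hI => ?_
  have hc := (Finset.mem_powersetCard.1 hI).2
  rw [Set.indicator_apply, if_congr (h.mem_weaklySupported_iff (by omega)) rfl rfl,
    angle_faceCone (h I (by omega)) (Finset.card_pos.1 (by omega))]

lemma integrable_faceContent_posHull
    (hφ : ∀ L : Grassmannian d (d - 1), φ {x | (x : E d) ∈ L.1} = 0) (hk : 1 ≤ k) (hkd : k < d) :
    Integrable (fun x : Fin n → Sph d => faceContent k (posHull x))
      (Measure.pi fun _ : Fin n => φ) := by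
  have hgen := ae_genPos_coords (n := n) hφ
  have hsum : Integrable (fun x : Fin n → Sph d => ∑ I ∈ Finset.powersetCard k Finset.univ,
      (weaklySupported I).indicator (fun x => orthantRatio (coords x) I fun _ => true) x)
      (Measure.pi fun _ : Fin n => φ) := by
    refine integrable_finsetSum _ fun I hI => ?_
    have hc := (Finset.mem_powersetCard.1 hI).2
    refine Integrable.of_bound ((measurable_orthantRatio I _).indicator
      (measurableSet_weaklySupported I)).aestronglyMeasurable 1 ?_
    filter_upwards [hgen] with x hx
    refine (norm_indicator_le_norm_self _ _).trans ?_
    rw [Real.norm_of_nonneg (orthantRatio_nonneg _ _ _)]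
    exact orthantRatio_le_one (hx I (by omega)) _
  refine hsum.congr ?_
  filter_upwards [hgen] with x hx
  exact (hx.faceContent_posHull hk hkd).symm

theorem hasCoverEfronExpectation_faceContent (hn : 1 ≤ n) (hsymm : φ.map (fun x => -x) = φ)
    (hφ : ∀ L : Grassmannian d (d - 1), φ {x | (x : E d) ∈ L.1} = 0) (hk : 1 ≤ k) (hkd : k < d) :
    HasCoverEfronExpectation φ n (faceContent k)
      ((n.choose k : ℝ) * (schlafliNumber ((n : ℤ) - k) (d - k) : ℝ) /
        (schlafliNumber n d : ℝ)) := by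
  classical
  have : Nonempty (Fin n) := ⟨⟨0, hn⟩⟩
  set π : Measure (Fin n → Sph d) := Measure.pi fun _ : Fin n => φ with hπ
  have hgen : ∀ᵐ x ∂π, GenPos d (coords x) := ae_genPos_coords hφ
  have hint : Integrable (fun x : Fin n → Sph d => faceContent k (posHull x)) π :=
    integrable_faceContent_posHull hφ hk hkd
  have hN : ∀ᵐ x ∂π, x ∈ {x : Fin n → Sph d | posHull x ≠ ⊤} ↔ x ∈ weaklySupported ∅ := by
    filter_upwards [hgen] with x hx
    rw [posHull_eq, hx.faceCone_univ_ne_top_iff,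
      hx.mem_weaklySupported_iff (by rw [Finset.card_empty]; omega)]
  have hprob : π.real {x | posHull x ≠ ⊤} = (schlafliNumber n d : ℝ) / 2 ^ n := by
    have h1 : π.real {x | posHull x ≠ ⊤} = π.real (weaklySupported ∅) := by
      rw [measureReal_def, measureReal_def, measure_congr (Filter.eventuallyEq_set.2 hN)]
    rw [h1, ← integral_indicator_one (measurableSet_weaklySupported ∅)]
    refine integral_eq_of_sum_flip hsymm ((integrable_const (1 : ℝ)).indicator
      (measurableSet_weaklySupported ∅)) ?_
    filter_upwards [hgen] with x hx
    have := hx.sum_supportedOn_empty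
    rw [Fintype.card_fin] at this
    rw [← this]
    refine Finset.sum_congr (by congr!) fun ε _ => ?_
    have hx' : GenPos d (coords (flip ε x)) := by
      rw [coords_flip]
      exact hx.signed ε
    rw [Set.indicator_apply, ← coords_flip]
    exact if_congr (hx'.mem_weaklySupported_iff (by rw [Finset.card_empty]; omega)) rfl rfl
  have hE : ∫ x, faceContent k (posHull x) ∂π =
      (n.choose k : ℝ) * (schlafliNumber ((n : ℤ) - k) (d - k) : ℝ) / 2 ^ n := by
    refine integral_eq_of_sum_flip hsymm hint ?_
    filter_upwards [hgen] with x hx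
    have := hx.sum_faceContent_faceCone hk hkd
    rw [Fintype.card_fin] at this
    rw [← this]
    exact Finset.sum_congr (by congr!) fun ε _ => by rw [posHull_eq, coords_flip]
  -- When the hull is the whole space, no index set of size `k` is supported, so the integral over
  -- the conditioning event equals the full integral.
  have hzero : ∀ᵐ x ∂π, x ∉ {x : Fin n → Sph d | posHull x ≠ ⊤} →
      faceContent k (posHull x) = 0 := by
    filter_upwards [hgen] with x hx hxN
    rw [posHull_eq, hx.faceCone_univ_ne_top_iff] at hxN
    rw [posHull_eq, hx.faceContent_faceCone hkd]
    refine Finset.sum_eq_zero fun I hI => if_neg fun hI' => hxN ?_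
    exact hx.supportedOn_mono (Finset.empty_subset I)
      (by rw [(Finset.mem_powersetCard.1 hI).2]; omega) hI'
  have hpos : π {x | posHull x ≠ ⊤} ≠ 0 := by
    intro h0
    rw [measureReal_def, h0, ENNReal.toReal_zero, eq_comm, div_eq_zero_iff] at hprob
    obtain ⟨m, rfl⟩ := Nat.exists_eq_succ_of_ne_zero (Nat.one_le_iff_ne_zero.1 hn)
    obtain ⟨e, rfl⟩ := Nat.exists_eq_succ_of_ne_zero (show d ≠ 0 by omega)
    refine hprob.elim (fun h => ?_) (pow_ne_zero _ two_ne_zero)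
    rw [Nat.cast_eq_zero, Nat.succ_eq_add_one, schlafliNumber_natCast_succ,
      Finset.sum_range_succ'] at h
    simp at h
  refine ⟨?_, ?_⟩
  · exact (hint.restrict).smul_measure (ENNReal.inv_ne_top.2 hpos)
  -- The conditional mean is the full integral divided by the probability, and the factors `2 ^ n`
  -- cancel.
  · rw [coverEfronMeasure, ProbabilityTheory.cond, integral_smul_measure, ← hπ,
      setIntegral_eq_integral_of_ae_compl_eq_zero hzero, hE, ENNReal.toReal_inv,
      ← measureReal_def, hprob, smul_eq_mul, inv_div, div_mul_div_comm, mul_comm,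
      mul_div_mul_right _ _ (by positivity)]

end CoverEfron

end RandomCones

end

theorem mainTheorem5 (d n : ℕ) (hd : 2 ≤ d) (hn : 1 ≤ n) :
    (∀ φ : Measure (RandomCones.Grassmannian d (d - 1)), IsProbabilityMeasure φ →
      (∀ v : RandomCones.E d, v ≠ 0 → φ {H | v ∈ H.1} = 0) →
      ∀ k : ℕ, 1 ≤ k → k ≤ d →
        RandomCones.HasSchlafliExpectation φ n (RandomCones.faceContent k)
          ((2 : ℝ) ^ (d - k) * (n.choose (d - k) : ℝ) / (RandomCones.schlafliNumber n d : ℝ))) ∧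
    (∀ φ : Measure (RandomCones.Sph d), IsProbabilityMeasure φ →
      φ.map (fun x => -x) = φ →
      (∀ L : RandomCones.Grassmannian d (d - 1), φ {x | (x : RandomCones.E d) ∈ L.1} = 0) →
      ∀ k : ℕ, 1 ≤ k → k ≤ d - 1 →
        RandomCones.HasCoverEfronExpectation φ n (RandomCones.faceContent k)
          ((n.choose k : ℝ) * (RandomCones.schlafliNumber ((n : ℤ) - k) (d - k) : ℝ) /
            (RandomCones.schlafliNumber n d : ℝ))) :=
  ⟨fun φ _ hφ _ hk hkd => RandomCones.hasSchlafliExpectation_faceContent (by omega) φ hφ hk hkd,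
    fun _ _ hsymm hφ _ hk hkd =>
      RandomCones.hasCoverEfronExpectation_faceContent hn hsymm hφ hk (by omega)⟩
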